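/- For a field $k$ let $K^{MW}_*(k)$ be its Milnor–Witt K-theory: the graded ring generated by symbols $[a]$ of degree $1$ ($a\in k^\times$) and $\eta$ of degree $-1$, subject to $[a][1-a]=0$ for $a\neq 1$, $[ab]=[a]+[b]+\eta[a][b]$, $\eta[a]=[a]\eta$ and $(2+\eta[-1])\eta=0$. Let $p\colon K^{MW}_1(k)\to K^M_1(k)=k^\times$ be the projection to Milnor K-theory, which kills $\eta$ and sends $[a]$ to $a$. If $\operatorname{char} k\neq 2$, let $I(k)$ be the fundamental ideal of the Witt ring of $k$, and write $\langle\langle a\rangle\rangle=\langle 1\rangle-\langle a\rangle$ and $\langle\langle a,b\rangle\rangle=\langle\langle a\rangle\rangle\langle\langle b\rangle\rangle\in I^2(k)$. Let $F$ be a number field, and for each place $v$ of $F$ let $F_v$ be the completion. Let $K^{MW}_1(\mathcal O_v)\subseteq K^{MW}_1(F_v)$ be the kernel of the residue map $\partial_v^{\pi}\colon K_1^{MW}(F_v)\to K_0^{MW}(k(v))$ if $v$ is finite (for any uniformizer $\pi$, on which the kernel does not depend), the kernel of the homomorphism induced by the signature of $[a]\mapsto\langle\langle a\rangle\rangle$ if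 $v$ is real, and all of $K^{MW}_1(F_v)$ if $v$ is complex. Likewise let $\mathcal O_v^\times$ be the units of the valuation ring of $F_v$ if $v$ is finite, $\mathbf R_{>0}$ if $v$ is real, and $\mathbf C^\times$ if $v$ is complex. Let $$\tilde{\mathbf J}_F=\varinjlim_S\Big(\prod_{v\in S}K^{MW}_1(F_v)\times\prod_{v\notin S}K^{MW}_1(\mathcal O_v)\Big),\qquad \mathbf J_F=\varinjlim_S\Big(\prod_{v\in S}F_v^\times\times\prod_{v\notin S}\mathcal O_v^\times\Big),$$ where $S$ runs over the finite sets of places of $F$, be the Milnor–Witt idèle group and the classical idèle group of $F$. **Proposition 4.2.** The projections $p\colon K^{MW}_1(F_v)\to F_v^\times$ induce a homomorphism $p\colon\tilde{\mathbf J}_F\to\mathbf J_F$, and there is a short exact sequence of abelian groups $$0\to\bigoplus_{v}I^2(F_v)\to\tilde{\mathbf J}_F\xrightarrow{\ p\ }\mathbf J_F\to 0,$$ where $v$ runs over all places of $F$ and the first map is given componentwise by homomorphisms $I^2(F_v)\to K^{MW}_1(F_v)$ with $\langle\langle a,b\rangle\rangle\mapsto\eta[a][b]$ for all $a,b\in F_v^\times$.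 -/

import Mathlib

open NumberField IsDedekindDomain Filter

noncomputable section

namespace MilnorWitt

universe u

/-! ## Milnor–Witt K-theory of a field -/

section KMW

variable (F : Type u) [Field F]

/-- The generators of Milnor–Witt K-theory: a symbol for every unit `a`, and `η`. -/
inductive Gen : Type u
  | symb (a : Fˣ)
  | eta

/-- The defining relations of Milnor–Witt K-theory. -/
inductive Rel : FreeAlgebra ℤ (Gen F) → FreeAlgebra ℤ (Gen F) → Prop
  | steinberg (a b : Fˣ) (h : (a : F) + b = 1) :
      Rel (FreeAlgebra.ι ℤ (Gen.symb a) * FreeAlgebra.ι ℤ (Gen.symb b)) 0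
  | mul (a b : Fˣ) :
      Rel (FreeAlgebra.ι ℤ (Gen.symb (a * b)))
        (FreeAlgebra.ι ℤ (Gen.symb a) + FreeAlgebra.ι ℤ (Gen.symb b)
          + FreeAlgebra.ι ℤ Gen.eta * FreeAlgebra.ι ℤ (Gen.symb a)
            * FreeAlgebra.ι ℤ (Gen.symb b))
  | comm (a : Fˣ) :
      Rel (FreeAlgebra.ι ℤ Gen.eta * FreeAlgebra.ι ℤ (Gen.symb a))
        (FreeAlgebra.ι ℤ (Gen.symb a) * FreeAlgebra.ι ℤ Gen.eta)
  | hyp :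
      Rel ((2 + FreeAlgebra.ι ℤ Gen.eta * FreeAlgebra.ι ℤ (Gen.symb (-1)))
        * FreeAlgebra.ι ℤ Gen.eta) 0

/-- The total Milnor–Witt K-theory ring `K^MW_*(F)`. -/
def KMW : Type u := RingQuot (Rel F)

instance : Ring (KMW F) := inferInstanceAs (Ring (RingQuot (Rel F)))

/-- The quotient map from the free ring onto `K^MW_*(F)`. -/
def mk : FreeAlgebra ℤ (Gen F) →+* KMW F := RingQuot.mkRingHom (Rel F)

variable {F}

lemma mk_rel {x y : FreeAlgebra ℤ (Gen F)} (h : Rel F x y) : mk F x = mk F y :=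
  RingQuot.mkRingHom_rel h

/-- The image of a generator in `K^MW_*(F)`. -/
def gen (x : Gen F) : KMW F := mk F (FreeAlgebra.ι ℤ x)

/-- The symbol `[a]`. -/
def symb (a : Fˣ) : KMW F := gen (Gen.symb a)

variable (F) in
/-- The element `η`. -/
def eta : KMW F := gen Gen.eta

/-- The degree of a generator: `[a]` has degree `1` and `η` has degree `-1`. -/
def Gen.deg : Gen F → ℤ
  | .symb _ => 1
  | .eta => -1

variable (F) in
/-- The graded piece `K^MW_n(F)`: the additive subgroup spanned by the words of degree `n` in the
generators. -/
def gradedPiece (n : ℤ) : AddSubgroup (KMW F) :=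
  AddSubgroup.closure {x | ∃ w : List (Gen F), (w.map Gen.deg).sum = n ∧ x = (w.map gen).prod}

variable (F) in
/-- The group `K^MW_1(F)`. -/
abbrev K1 : AddSubgroup (KMW F) := gradedPiece F 1

lemma symb_mem (a : Fˣ) : symb a ∈ K1 F :=
  AddSubgroup.subset_closure ⟨[Gen.symb a], by simp [Gen.deg], by simp [symb]⟩

lemma symb_mul_symb (a b : Fˣ) (h : (a : F) + b = 1) : symb a * symb b = 0 := by
  simpa [symb, gen] using mk_rel (Rel.steinberg a b h)

lemma symb_mul (a b : Fˣ) : symb (a * b) = symb a + symb b + eta F * symb a * symb b := by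
  simpa [symb, gen, eta] using mk_rel (Rel.mul a b)

lemma eta_comm (a : Fˣ) : eta F * symb a = symb a * eta F := by
  simpa [symb, gen, eta] using mk_rel (Rel.comm a)

lemma hyp_eta : (2 + eta F * symb (-1)) * eta F = 0 := by
  have h := mk_rel (Rel.hyp (F := F))
  rw [map_mul, map_add, map_ofNat, map_mul, map_zero] at h
  exact h

/-- The universal property of `K^MW_*(F)`. -/
def lift {R : Type*} [Ring R] (s : Fˣ → R) (e : R)
    (h1 : ∀ a b : Fˣ, (a : F) + b = 1 → s a * s b = 0)
    (h2 : ∀ a b, s (a * b) = s a + s b + e * s a * s b)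
    (h3 : ∀ a, e * s a = s a * e) (h4 : (2 + e * s (-1)) * e = 0) : KMW F →+* R :=
  RingQuot.lift (r := Rel F)
    ⟨(FreeAlgebra.lift ℤ
        (fun g : Gen F => match g with | .symb a => s a | .eta => e)).toRingHom, by
      intro x y h
      induction h with
      | steinberg a b h => simpa using h1 a b h
      | mul a b => simpa using h2 a b
      | comm a => simpa using h3 a
      | hyp => rw [map_mul, map_add, map_ofNat]; simpa using h4⟩

section lift

variable {R : Type*} [Ring R] (s : Fˣ → R) (e : R)
    (h1 : ∀ a b : Fˣ, (a : F) + b = 1 → s a * s b = 0)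
    (h2 : ∀ a b, s (a * b) = s a + s b + e * s a * s b)
    (h3 : ∀ a, e * s a = s a * e) (h4 : (2 + e * s (-1)) * e = 0)

@[simp] lemma lift_symb (a : Fˣ) : lift s e h1 h2 h3 h4 (symb a) = s a :=
  (RingQuot.lift_mkRingHom_apply _ _ _).trans (by simp)

@[simp] lemma lift_eta : lift s e h1 h2 h3 h4 (eta F) = e :=
  (RingQuot.lift_mkRingHom_apply _ _ _).trans (by simp)

end lift

lemma induction {P : KMW F → Prop} (hz : ∀ n : ℤ, P n) (hs : ∀ a, P (symb a)) (he : P (eta F))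
    (hm : ∀ x y, P x → P y → P (x * y)) (ha : ∀ x y, P x → P y → P (x + y)) (x : KMW F) : P x := by
  obtain ⟨y, rfl⟩ := RingQuot.mkRingHom_surjective (Rel F) x
  change P (mk F y)
  induction y using FreeAlgebra.induction with
  | grade0 r => simpa using hz r
  | grade1 g =>
    cases g with
    | symb a => exact hs a
    | eta => exact he
  | mul a b h h' => rw [map_mul]; exact hm _ _ h h'
  | add a b h h' => rw [map_add]; exact ha _ _ h h'

end KMW

/-! ## The projection `K^MW_1(F) → K^M_1(F) = Fˣ` -/

section proj

variable {F : Type u} [Field F]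

/-- The endomorphism `(x, n) ↦ (n • a, 0)` of `Fˣ × ℤ`. -/
def shift (a : Fˣ) : Module.End ℤ (Additive Fˣ × ℤ) :=
  (LinearMap.toSpanSingleton ℤ (Additive Fˣ × ℤ) (Additive.ofMul a, 0)).comp
    (LinearMap.snd ℤ (Additive Fˣ) ℤ)

@[simp] lemma shift_apply (a : Fˣ) (q : Additive Fˣ × ℤ) :
    shift a q = (q.2 • Additive.ofMul a, 0) := by
  simp [shift]

variable (F) in
/-- The quotient of Milnor–Witt K-theory which kills `η` and all products `[a][b]`, i.e. Milnor
K-theory `K^M_*(F) = K^MW_*(F)/η` modulo its part of degree at least `2`. This is the square-zero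
extension `ℤ ⊕ Fˣ`, realized by its action on itself. -/
def truncation : KMW F →+* Module.End ℤ (Additive Fˣ × ℤ) :=
  lift (F := F) shift 0
    (fun a b _ => LinearMap.ext fun q => by simp)
    (fun a b => LinearMap.ext fun q => by simp [zsmul_add])
    (by simp) (by simp)

/-- The projection `p` to Milnor K-theory on the degree one part, `K^MW_1(F) → K^M_1(F) = Fˣ`: it
kills the multiples of `η` and sends `[a]` to `a`. -/
def proj : K1 F →+ Additive Fˣ where
  toFun x := (truncation F x (0, 1)).1
  map_zero' := by simp
  map_add' x y := by simp

lemma proj_symb (a : Fˣ) : proj ⟨symb a, symb_mem a⟩ = Additive.ofMul a := by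
  simp [proj, truncation]

end proj

/-! ## Elementary identities in Milnor–Witt K-theory -/

section identities

variable {F : Type u} [Field F]

variable (F) in
/-- The hyperbolic element `h = 2 + η[-1]`. -/
def hyp : KMW F := 2 + eta F * symb (-1)

/-- The element `⟨a⟩ = 1 + η[a]`. -/
def angle (a : Fˣ) : KMW F := 1 + eta F * symb a

lemma hyp_mul_eta : hyp F * eta F = 0 := hyp_eta

lemma eta_mul_hyp : eta F * hyp F = 0 := by
  rw [← hyp_mul_eta, hyp, mul_add, add_mul, mul_assoc (eta F) (symb (-1)), ← eta_comm, two_mul,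
    mul_two]

lemma hyp_eq : hyp F = 1 + angle (-1) := by rw [hyp, angle, ← add_assoc, one_add_one_eq_two]

lemma symb_mul' (a b : Fˣ) : symb (a * b) = symb a + angle a * symb b := by
  rw [symb_mul, angle, add_mul, one_mul, add_assoc]

lemma symb_one_aux : symb (1 : Fˣ) = hyp F * symb (-1) := by
  have h := symb_mul' (-1 : Fˣ) (-1)
  rw [neg_one_mul, neg_neg] at h
  rw [h, hyp_eq, add_mul, one_mul]

lemma symb_one : symb (1 : Fˣ) = 0 := by
  have h := symb_mul (1 : Fˣ) 1
  have h1 : eta F * symb 1 = 0 := by rw [symb_one_aux, ← mul_assoc, eta_mul_hyp, zero_mul]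
  rw [h1, mul_one, zero_mul, add_zero] at h
  simpa using h

lemma symb_mul_neg (a : Fˣ) : symb a * symb (-a) = 0 := by
  by_cases ha : a = 1
  · rw [ha, symb_one, zero_mul]
  have ha' : (a : F) ≠ 1 := fun h => ha (Units.ext (by simpa using h))
  have ha0 : (a : F) ≠ 0 := a.ne_zero
  let b : Fˣ := Units.mk0 (1 - a) (sub_ne_zero.2 (Ne.symm ha'))
  let c : Fˣ := Units.mk0 (1 - (a : F)⁻¹) (by
    rw [sub_ne_zero]; intro h; exact ha' (by rw [← inv_inv (a : F), ← h, inv_one]))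
  have hb : b = c * (-a) := by
    ext
    simp only [b, c, Units.val_mk0, Units.val_mul, Units.val_neg]
    field_simp
    ring
  have h1 : symb a * symb b = 0 := symb_mul_symb a b (by simp [b])
  have h2 : symb a⁻¹ * symb c = 0 := symb_mul_symb a⁻¹ c (by simp [c])
  have h3 : symb a * symb c = 0 := by
    have h := symb_mul a a⁻¹
    rw [mul_inv_cancel, symb_one] at h
    have h' := congrArg (· * symb c) h
    simp only [zero_mul, add_mul, mul_assoc, h2, mul_zero, add_zero] at h'
    exact h'.symm
  rw [hb, symb_mul c (-a), eta_comm, mul_assoc, mul_add, mul_add, h3, zero_add, ← mul_assoc,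
    h3, zero_mul, add_zero] at h1
  exact h1

lemma eta_symb_comm (a b : Fˣ) : eta F * symb a * symb b = eta F * symb b * symb a := by
  have h := symb_mul a b
  rw [mul_comm, symb_mul b a, add_comm (symb b)] at h
  exact (add_left_cancel h).symm

lemma angle_one : angle (1 : Fˣ) = 1 := by rw [angle, symb_one, mul_zero, add_zero]

lemma eta_angle_comm (b : Fˣ) : eta F * angle b = angle b * eta F := by
  rw [angle, mul_add, add_mul, mul_assoc, ← eta_comm, mul_one, one_mul]

lemma symb_angle_comm (a b : Fˣ) : symb a * angle b = angle b * symb a := by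
  rw [angle, mul_add, add_mul, ← mul_assoc, ← eta_comm, eta_symb_comm, mul_one, one_mul]

lemma angle_mul (a b : Fˣ) : angle a * angle b = angle (a * b) := by
  rw [angle.eq_1 (a * b), symb_mul', mul_add, ← mul_assoc, eta_angle_comm, ← add_assoc,
    mul_assoc, ← angle.eq_1 a]
  conv_lhs => rw [angle.eq_1 b, mul_add, mul_one]

lemma angle_comm (a b : Fˣ) : angle a * angle b = angle b * angle a := by
  rw [angle_mul, angle_mul, mul_comm]

lemma hyp_mul_angle (a : Fˣ) : hyp F * angle a = hyp F := by
  rw [angle, mul_add, mul_one, ← mul_assoc, hyp_mul_eta, zero_mul, add_zero]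

lemma angle_mul_hyp (a : Fˣ) : angle a * hyp F = hyp F := by
  rw [hyp_eq, mul_add, mul_one, angle_comm, ← one_add_mul, ← hyp_eq, hyp_mul_angle]

lemma symb_mul_hyp (a : Fˣ) : symb a * hyp F = hyp F * symb a := by
  rw [hyp_eq, mul_add, add_mul, symb_angle_comm, mul_one, one_mul]

lemma angle_neg_one_sq : angle (-1 : Fˣ) * angle (-1) = 1 := by
  rw [angle_mul, neg_one_mul, neg_neg, angle_one]

lemma angle_mul_symb (a : Fˣ) : angle a * symb a = angle (-1) * symb a := by
  have h0 : symb (-1 : Fˣ) + angle (-1) * symb (-1) = 0 := by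
    rw [← symb_mul', neg_one_mul, neg_neg, symb_one]
  have h1 : symb a * symb (-1) + angle (-1) * (symb a * symb a) = 0 := by
    rw [← mul_assoc, ← symb_angle_comm, mul_assoc, ← mul_add, ← symb_mul', neg_one_mul,
      symb_mul_neg]
  have h2 : symb a * symb a = symb a * symb (-1) := by
    have h := congrArg (angle (-1) * ·) h1
    simp only [mul_add, mul_zero] at h
    rw [← mul_assoc (angle (-1)) (angle (-1)), angle_neg_one_sq, one_mul, ← mul_assoc,
      ← symb_angle_comm, mul_assoc, eq_neg_of_add_eq_zero_right h0, mul_neg] at h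
    exact (neg_add_eq_zero.1 h).symm
  rw [angle, angle, add_mul, add_mul, mul_assoc, h2, ← mul_assoc, eta_symb_comm]

/-- The element `ε = -⟨-1⟩`. -/
def eps (F : Type u) [Field F] : KMW F := -angle (-1)

/-- The element `n_ε`, i.e. `∑_{i = 1}^n ⟨(-1)^(i-1)⟩` for `n ≥ 0` and `ε (-n)_ε` for `n < 0`. -/
def nEps (F : Type u) [Field F] (n : ℤ) : KMW F := (n / 2) • hyp F + (n % 2) • 1

lemma eps_comm (x : Fˣ) : symb x * eps F = eps F * symb x := by
  rw [eps, mul_neg, neg_mul, symb_angle_comm]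

lemma eta_eps : eta F * eps F = eta F := by
  have h := eta_mul_hyp (F := F)
  rw [hyp_eq, mul_add, mul_one] at h
  rw [eps, mul_neg, eq_neg_of_add_eq_zero_right h, neg_neg]

lemma eps_eta : eps F * eta F = eta F := by
  rw [eps, neg_mul, ← eta_angle_comm, ← mul_neg, ← eps, eta_eps]

lemma eps_angle_comm (a : Fˣ) : eps F * angle a = angle a * eps F := by
  rw [eps, mul_neg, neg_mul, angle_comm]

lemma nEps_even (j : ℤ) : nEps F (2 * j) = j • hyp F := by
  simp [nEps]

lemma nEps_odd (j : ℤ) : nEps F (2 * j + 1) = j • hyp F + 1 := by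
  have h1 : (2 * j + 1) / 2 = j := by omega
  have h2 : (2 * j + 1) % 2 = 1 := by omega
  rw [nEps, h1, h2, one_smul]

lemma nEps_zero : nEps F 0 = 0 := by simp [nEps]

lemma nEps_comm_angle (n : ℤ) (a : Fˣ) : nEps F n * angle a = angle a * nEps F n := by
  rw [nEps, add_mul, mul_add, smul_mul_assoc, mul_smul_comm, hyp_mul_angle, angle_mul_hyp,
    smul_mul_assoc, mul_smul_comm, one_mul, mul_one]

lemma nEps_comm_eta (n : ℤ) : nEps F n * eta F = eta F * nEps F n := by
  rw [nEps, add_mul, mul_add, smul_mul_assoc, mul_smul_comm, hyp_mul_eta, eta_mul_hyp,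
    smul_mul_assoc, mul_smul_comm, one_mul, mul_one]

lemma nEps_comm_symb (n : ℤ) (a : Fˣ) : nEps F n * symb a = symb a * nEps F n := by
  rw [nEps, add_mul, mul_add, smul_mul_assoc, mul_smul_comm, symb_mul_hyp,
    smul_mul_assoc, mul_smul_comm, one_mul, mul_one]

lemma nEps_add (m n : ℤ) : nEps F (m + n) = nEps F m * angle ((-1) ^ n) + nEps F n := by
  rcases Int.even_or_odd' n with ⟨j, rfl | rfl⟩
  · rw [(even_two_mul j).neg_one_zpow, angle_one, mul_one]
    rcases Int.even_or_odd' m with ⟨i, rfl | rfl⟩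
    · rw [← mul_add, nEps_even, nEps_even, nEps_even, add_smul]
    · rw [show 2 * i + 1 + 2 * j = 2 * (i + j) + 1 by ring, nEps_even, nEps_odd, nEps_odd, add_smul]
      abel
  · rw [(odd_two_mul_add_one j).neg_one_zpow]
    rcases Int.even_or_odd' m with ⟨i, rfl | rfl⟩
    · rw [show 2 * i + (2 * j + 1) = 2 * (i + j) + 1 by ring, nEps_even, nEps_odd, nEps_odd,
        add_smul, smul_mul_assoc, hyp_mul_angle]
      abel
    · rw [show 2 * i + 1 + (2 * j + 1) = 2 * (i + j + 1) by ring, nEps_even, nEps_odd, nEps_odd,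
        add_smul, add_smul, one_smul, add_mul, one_mul, smul_mul_assoc, hyp_mul_angle]
      nth_rewrite 3 [hyp_eq]
      abel

/-- The vanishing behind the residue of `[a][1 - a]` for `a` with a pole of order `-n`. -/
lemma steinberg_aux (n : ℤ) (u : Fˣ) :
    symb u * (nEps F n * angle (-u))
      + nEps F n * angle u * (eps F * symb ((-1) ^ n * (-u))) = 0 := by
  have e1 : angle (-u) * symb u = symb u := by
    have h := symb_mul_neg (-u)
    rw [neg_neg] at h
    rw [angle, add_mul, one_mul, mul_assoc, h, mul_zero, add_zero]
  have e2 : hyp F * eps F = -hyp F := by rw [eps, mul_neg, hyp_mul_angle]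
  have e3 : hyp F * symb (-u) = hyp F * symb u := by
    rw [← neg_one_mul, symb_mul', mul_add, ← symb_one_aux, symb_one, zero_add, ← mul_assoc,
      hyp_mul_angle]
  have e4 : angle u * (eps F * symb u) = -symb u := by
    rw [← mul_assoc, ← eps_angle_comm, mul_assoc, angle_mul_symb, eps, neg_mul, ← mul_assoc,
      angle_neg_one_sq, one_mul]
  have e5 : ∀ x : KMW F, hyp F * (angle u * (eps F * x)) = -(hyp F * x) := fun x => by
    rw [← mul_assoc, hyp_mul_angle, ← mul_assoc, e2, neg_mul]
  rw [nEps_comm_angle, ← mul_assoc, symb_angle_comm, e1, ← nEps_comm_symb, mul_assoc]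
  rcases Int.even_or_odd' n with ⟨j, rfl | rfl⟩
  · rw [(even_two_mul j).neg_one_zpow, one_mul, nEps_even, smul_mul_assoc, smul_mul_assoc, e5, e3,
      smul_neg, add_neg_cancel]
  · rw [(odd_two_mul_add_one j).neg_one_zpow, neg_one_mul, neg_neg, nEps_odd, add_mul, add_mul,
      smul_mul_assoc, smul_mul_assoc, e5, one_mul, one_mul, e4, smul_neg]
    abel

end identities

/-! ## The residue map -/

section residue

variable {K : Type u} [Field K] {k : Type u} [Field k]

/-- The ring homomorphism `K^MW_*(K) → M_2(K^MW_*(k))` attached to an order function `ord` and an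
angular component `ac` (so that `a = π ^ ord a * u` where `u` is a unit with residue class `ac a`):
it sends `η` to the scalar matrix `η`, and `[π ^ n * u]` to the matrix with rows `[ū], 0` and
`n_ε⟨ū⟩, ε[(-1) ^ n ū]`. This is left multiplication by `[ū] + ξ n_ε⟨ū⟩`, with respect to the right
basis `1, ξ`, on the ring obtained from `K^MW_*(k)` by adjoining an element `ξ` of degree one with
`ξ² = ξ[-1]`. The lower left entry, i.e. the coefficient of `ξ`, is the residue. -/
def residueMatrix (ord : Kˣ → ℤ) (ac : Kˣ →* kˣ) (hneg : ac (-1) = -1)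
    (hord : ∀ a b, ord (a * b) = ord a + ord b)
    (hst : ∀ a b : Kˣ, (a : K) + b = 1 →
      (ord a = 0 ∧ ord b = 0 ∧ (ac a : k) + ac b = 1) ∨ (ord a = 0 ∧ ac a = 1) ∨
      (ord b = 0 ∧ ac b = 1) ∨ (ord a = ord b ∧ ac b = -ac a)) :
    KMW K →+* Matrix (Fin 2) (Fin 2) (KMW k) :=
  lift (F := K)
    (fun a => !![symb (ac a), 0;
      nEps k (ord a) * angle (ac a), eps k * symb ((-1) ^ ord a * ac a)])
    !![eta k, 0; 0, eta k]
    (by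
      intro a b h
      have e : ∀ x y : kˣ, eps k * symb x * (eps k * symb y) = eps k * eps k * (symb x * symb y) :=
        fun x y => by rw [mul_assoc, ← mul_assoc (symb x), eps_comm]; simp only [mul_assoc]
      have c1 : ∀ (n : ℤ) (x y : kˣ), nEps k n * angle x * symb y = symb y * (nEps k n * angle x) :=
        fun n x y => by
          rw [mul_assoc, ← symb_angle_comm, ← mul_assoc, nEps_comm_symb, mul_assoc]
      have c2 : ∀ (n : ℤ) (x y : kˣ), eps k * symb y * (nEps k n * angle x)
          = nEps k n * angle x * (eps k * symb y) := fun n x y => by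
        rw [mul_assoc, ← c1, ← mul_assoc (eps k), ← mul_assoc (eps k), ← mul_assoc (nEps k n * _)]
        congr 1
        rw [eps, neg_mul, neg_mul, mul_neg, ← nEps_comm_angle, mul_assoc, mul_assoc, angle_comm]
      have key : symb (ac a) * symb (ac b) = 0 ∧
          nEps k (ord a) * angle (ac a) * symb (ac b)
            + eps k * symb ((-1) ^ ord a * ac a) * (nEps k (ord b) * angle (ac b)) = 0 ∧
          symb ((-1) ^ ord a * ac a) * symb ((-1) ^ ord b * ac b) = 0 := by
        rw [c1, c2]
        rcases hst a b h with ⟨h1, h2, h3⟩ | ⟨h1, h2⟩ | ⟨h1, h2⟩ | ⟨h1, h2⟩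
        · have := symb_mul_symb _ _ h3
          simp [h1, h2, this, nEps_zero]
        · simp [h1, h2, symb_one, nEps_zero]
        · simp [h1, h2, symb_one, nEps_zero]
        · have h3 : ac a = -ac b := by rw [h2, neg_neg]
          refine ⟨by rw [h2]; exact symb_mul_neg _, ?_, by
            rw [← h1, h2, mul_neg]; exact symb_mul_neg _⟩
          rw [h1, h3]
          exact steinberg_aux _ _
      ext i j
      fin_cases i <;> fin_cases j <;> simp [Matrix.mul_apply, Fin.sum_univ_two, key.1, key.2.1,
        key.2.2, e])
    (by
      intro a b
      have e : symb ((-1) ^ ord (a * b) * ac (a * b) : kˣ)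
          = symb (((-1) ^ ord a * ac a) * ((-1) ^ ord b * ac b)) := by
        congr 1
        rw [hord, zpow_add, map_mul, mul_mul_mul_comm]
      have e1 : nEps k (ord (a * b)) * angle (ac (a * b)) =
          nEps k (ord a) * angle (ac a) + nEps k (ord b) * angle (ac b) +
          (eta k * (nEps k (ord a) * angle (ac a)) * symb (ac b) +
            eta k * (eps k * symb ((-1) ^ ord a * ac a)) * (nEps k (ord b) * angle (ac b))) := by
        generalize hz : ((-1) ^ ord a * ac a : kˣ) = z
        have f0 : ∀ (n : ℤ) (x y : kˣ), eta k * symb y * (nEps k n * angle x)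
            = nEps k n * angle x * (eta k * symb y) := fun n x y => by
          have : angle y * (nEps k n * angle x) = nEps k n * angle x * angle y := by
            rw [← mul_assoc, ← nEps_comm_angle, mul_assoc, mul_assoc, angle_comm]
          rw [angle.eq_1 y, add_mul, mul_add, one_mul, mul_one] at this
          exact add_left_cancel this
        have f1 : eta k * (eps k * symb z) = eta k * symb z := by rw [← mul_assoc, eta_eps]
        have f2 : nEps k (ord a) * angle (ac a) + eta k * (nEps k (ord a) * angle (ac a)) *
            symb (ac b) = nEps k (ord a) * angle (ac a * ac b) := by
          rw [← angle_mul, ← mul_assoc (eta k), ← nEps_comm_eta, mul_assoc (nEps k (ord a)),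
            eta_angle_comm, angle.eq_1 (ac b)]
          simp only [mul_add, mul_one, mul_assoc]
        have f3 : nEps k (ord b) * angle (ac b) + eta k * symb z * (nEps k (ord b) * angle (ac b))
            = nEps k (ord b) * angle ((-1) ^ ord a) * angle (ac a * ac b) := by
          rw [f0, mul_assoc (nEps k (ord b)) (angle ((-1) ^ ord a)), angle_mul,
            ← mul_assoc ((-1) ^ ord a : kˣ), hz, mul_comm z, ← angle_mul, angle.eq_1 z]
          simp only [mul_add, mul_one, mul_assoc]
        rw [f1, hord, add_comm (ord a), nEps_add, map_mul, add_mul, ← f2, ← f3]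
        abel
      have e2 : eps k * symb ((-1) ^ ord (a * b) * ac (a * b) : kˣ) =
          eps k * symb ((-1) ^ ord a * ac a) + eps k * symb ((-1) ^ ord b * ac b) +
          eta k * (eps k * symb ((-1) ^ ord a * ac a)) * (eps k * symb ((-1) ^ ord b * ac b)) := by
        rw [e, symb_mul, mul_add, mul_add]
        generalize ((-1) ^ ord a * ac a : kˣ) = x
        generalize ((-1) ^ ord b * ac b : kˣ) = y
        congr 1
        calc eps k * (eta k * symb x * symb y) = eps k * eta k * symb x * symb y := by
              simp only [mul_assoc]
          _ = eta k * eps k * symb x * symb y := by rw [eps_eta, eta_eps]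
          _ = eta k * (symb x * eps k) * symb y := by rw [eps_comm]; simp only [mul_assoc]
          _ = eta k * eps k * symb x * eps k * symb y := by rw [eta_eps]; simp only [mul_assoc]
          _ = eta k * (eps k * symb x) * (eps k * symb y) := by simp only [mul_assoc]
      ext i j
      fin_cases i <;> fin_cases j
      · simp [symb_mul]
      · simp
      · simpa [Matrix.mul_apply, Fin.sum_univ_two] using e1
      · simpa [Matrix.mul_apply, Fin.sum_univ_two] using e2)
    (by
      intro a
      have e1 : eta k * (nEps k (ord a) * angle (ac a))
          = nEps k (ord a) * angle (ac a) * eta k := by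
        rw [mul_assoc, ← eta_angle_comm, ← mul_assoc, ← mul_assoc, nEps_comm_eta]
      have e2 : ∀ x : kˣ, eta k * (eps k * symb x) = eps k * symb x * eta k := fun x => by
        rw [mul_assoc, ← eta_comm, ← mul_assoc, ← mul_assoc, eta_eps, eps_eta]
      ext i j
      fin_cases i <;> fin_cases j <;>
        simp [Matrix.mul_apply, Fin.sum_univ_two, e1, e2, eta_comm])
    (by
      have h1 : ord 1 = 0 := by simpa using hord 1 1
      have h2 : ord (-1) = 0 := by
        have := hord (-1) (-1)
        rw [neg_one_mul, neg_neg, h1] at this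
        omega
      have h3 : (2 : Matrix (Fin 2) (Fin 2) (KMW k)) = !![2, 0; 0, 2] := by
        have h5 : (2 : Matrix (Fin 2) (Fin 2) (KMW k)) = 1 + 1 := one_add_one_eq_two.symm
        rw [h5, Matrix.one_fin_two]
        ext i j
        fin_cases i <;> fin_cases j <;> simp [one_add_one_eq_two]
      have h4 : (2 + eta k * (eps k * symb (-1))) * eta k = 0 := by
        rw [← mul_assoc (eta k), eta_eps]
        exact hyp_eta
      rw [h3]
      ext i j
      fin_cases i <;> fin_cases j <;>
        simp [Matrix.mul_apply, Fin.sum_univ_two, h2, hneg, nEps_zero, hyp_eta, h4])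

/-- The ring homomorphism to `ℤ` killing `η` and all symbols. On `K^MW_0` it is the rank,
`⟨a⟩ = 1 + η[a] ↦ 1`. -/
def rank : KMW K →+* ℤ :=
  lift (F := K) (fun _ => 0) 0 (by simp) (by simp) (by simp) (by simp)

end residue

section valuation

open WithZero

variable {K : Type u} [Field K] (w : Valuation K (WithZero (Multiplicative ℤ)))

/-- The normalized additive order of a unit with respect to a `ℤᵐ⁰`-valued valuation. -/
def ord (a : Kˣ) : ℤ := -log (w a)

lemma val_eq (a : Kˣ) : w a = exp (-ord w a) := by
  rw [ord, neg_neg, exp_log (by simp)]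

lemma ord_eq {a : Kˣ} {n : ℤ} (h : w a = exp (-n)) : ord w a = n := by
  rw [ord, h, log_exp, neg_neg]

lemma ord_mul (a b : Kˣ) : ord w (a * b) = ord w a + ord w b := by
  rw [ord, Units.val_mul, map_mul, log_mul (by simp) (by simp), ord, ord]
  ring

/-- A uniformizer: an element of order `1`. -/
def IsUniformizer (π : Kˣ) : Prop := ord w π = 1

variable {w} {π : Kˣ}

lemma unitPart_val (hπ : IsUniformizer w π) (a : Kˣ) :
    w ((a * π ^ (-ord w a) : Kˣ) : K) = 1 := by
  rw [Units.val_mul, Units.val_zpow_eq_zpow_val, map_mul, map_zpow₀, val_eq, val_eq w π,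
    show ord w π = 1 from hπ, ← exp_zsmul, ← exp_add]
  simp

lemma unitPart_mem (hπ : IsUniformizer w π) (a : Kˣ) :
    a * π ^ (-ord w a) ∈ w.valuationSubring.unitGroup :=
  (Valuation.mem_unitGroup_iff K w _).2 (unitPart_val hπ a)

/-- The angular component `a = π ^ n * u ↦ ū` with respect to a uniformizer `π`. -/
def angular (hπ : IsUniformizer w π) : Kˣ →* (IsLocalRing.ResidueField w.valuationSubring)ˣ :=
  (ValuationSubring.unitGroupToResidueFieldUnits w.valuationSubring).comp
    { toFun := fun a => ⟨a * π ^ (-ord w a), unitPart_mem hπ a⟩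
      map_one' := by
        have h1 : ord w 1 = 0 := by simpa using ord_mul w 1 1
        simp [h1]
      map_mul' := fun a b => by
        apply Subtype.ext
        simp only [Subgroup.coe_mul, ord_mul, neg_add, zpow_add]
        exact mul_mul_mul_comm _ _ _ _ }

lemma angular_val (hπ : IsUniformizer w π) (a : Kˣ) :
    (angular hπ a : IsLocalRing.ResidueField w.valuationSubring) =
      IsLocalRing.residue w.valuationSubring
        ⟨(a * π ^ (-ord w a) : Kˣ), (unitPart_val hπ a).le⟩ := rfl

lemma residue_eq_of_val_sub {x y : w.valuationSubring} (h : w (x - y : K) < 1) :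
    IsLocalRing.residue w.valuationSubring x = IsLocalRing.residue w.valuationSubring y := by
  rw [← sub_eq_zero, ← map_sub, IsLocalRing.residue_eq_zero_iff, Valuation.mem_maximalIdeal_iff]
  exact h

lemma angular_neg_one (hπ : IsUniformizer w π) : angular hπ (-1) = -1 := by
  have h1 : ord w (-1) = 0 := ord_eq w (by simp)
  ext
  rw [angular_val, Units.val_neg, Units.val_one, ← map_one (IsLocalRing.residue _), ← map_neg]
  congr 1
  ext
  simp [h1]

lemma angular_of_pos {a b : Kˣ} (hπ : IsUniformizer w π) (h : (a : K) + b = 1) (ha : 0 < ord w a) :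
    ord w b = 0 ∧ angular hπ b = 1 := by
  have hb : (b : K) = 1 - a := eq_sub_of_add_eq' h
  have ha' : w a < 1 := by
    rw [val_eq, ← exp_zero, exp_lt_exp]; omega
  have h0 : ord w b = 0 := ord_eq w (by rw [hb, Valuation.map_one_sub_of_lt _ ha']; simp)
  refine ⟨h0, ?_⟩
  ext
  rw [angular_val, Units.val_one, ← map_one (IsLocalRing.residue _)]
  apply residue_eq_of_val_sub
  simp [h0, hb, ha']

lemma angular_steinberg (hπ : IsUniformizer w π) (a b : Kˣ) (h : (a : K) + b = 1) :
    (ord w a = 0 ∧ ord w b = 0 ∧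
      (angular hπ a : IsLocalRing.ResidueField w.valuationSubring) + angular hπ b = 1) ∨
    (ord w a = 0 ∧ angular hπ a = 1) ∨ (ord w b = 0 ∧ angular hπ b = 1) ∨
    (ord w a = ord w b ∧ angular hπ b = -angular hπ a) := by
  have hlt : ∀ c d : Kˣ, (c : K) + d = 1 → ord w c < 0 → ord w d = ord w c := by
    intro c d h hc
    have hd : (d : K) = 1 - c := eq_sub_of_add_eq' h
    refine ord_eq w ?_
    rw [hd, Valuation.map_sub_swap, Valuation.map_sub_eq_of_lt_left, val_eq]
    rw [map_one, val_eq, ← exp_zero, exp_lt_exp]; omega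
  rcases lt_trichotomy (ord w a) 0 with ha | ha | ha
  · refine Or.inr (Or.inr (Or.inr ⟨(hlt a b h ha).symm, ?_⟩))
    ext
    rw [Units.val_neg, angular_val, angular_val, ← map_neg]
    apply residue_eq_of_val_sub
    have e : ((b * π ^ (-ord w b) : Kˣ) : K) - -((a * π ^ (-ord w a) : Kˣ) : K)
        = ((π ^ (-ord w a) : Kˣ) : K) := by
      rw [hlt a b h ha, sub_neg_eq_add, Units.val_mul, Units.val_mul, ← add_mul, add_comm, h,
        one_mul]
    change w (((b * π ^ (-ord w b) : Kˣ) : K) - -((a * π ^ (-ord w a) : Kˣ) : K)) < 1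
    rw [e, Units.val_zpow_eq_zpow_val, map_zpow₀, val_eq w π, show ord w π = 1 from hπ,
      ← exp_zsmul, ← exp_zero, exp_lt_exp]
    simpa using ha
  · rcases lt_trichotomy (ord w b) 0 with hb | hb | hb
    · have := hlt b a (by rw [add_comm]; exact h) hb
      omega
    · refine Or.inl ⟨ha, hb, ?_⟩
      rw [angular_val, angular_val, ← map_one (IsLocalRing.residue _), ← map_add]
      congr 1
      ext
      simp [ha, hb, h]
    · exact Or.inr (Or.inl (angular_of_pos hπ (by rw [add_comm]; exact h) hb))
  · exact Or.inr (Or.inr (Or.inl (angular_of_pos hπ h ha)))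

/-- Morel's residue map `∂^π : K^MW_*(K) → K^MW_{*-1}(k)` of a discretely valued field with respect
to a uniformizer `π`, as an additive map on the total groups. It is characterized by
`∂(η x) = η ∂(x)`, `∂([π][u_1]⋯[u_n]) = [ū_1]⋯[ū_n]` and `∂([u_1]⋯[u_n]) = 0` for all units
`u_i`; see the lemmas below. -/
def residueMap (hπ : IsUniformizer w π) :
    KMW K →+ KMW (IsLocalRing.ResidueField w.valuationSubring) where
  toFun x := residueMatrix (ord w) (angular hπ) (angular_neg_one hπ) (ord_mul w)
    (angular_steinberg hπ) x 1 0
  map_zero' := by simp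
  map_add' x y := by simp

lemma residueMap_eta_mul (hπ : IsUniformizer w π) (x : KMW K) :
    residueMap hπ (eta K * x) = eta _ * residueMap hπ x := by
  simp [residueMap, residueMatrix, Matrix.mul_apply, Fin.sum_univ_two]

lemma residueMatrix_units (hπ : IsUniformizer w π) (l : List Kˣ) (hl : ∀ u ∈ l, ord w u = 0) :
    ∃ d, residueMatrix (ord w) (angular hπ) (angular_neg_one hπ) (ord_mul w)
      (angular_steinberg hπ) (l.map symb).prod
        = !![(l.map fun u => symb (angular hπ u)).prod, 0; 0, d] := by
  induction l with
  | nil => exact ⟨1, by simp [Matrix.one_fin_two]⟩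
  | cons u l ih =>
    obtain ⟨d, hd⟩ := ih fun v hv => hl v (List.mem_cons_of_mem _ hv)
    have h0 : ord w u = 0 := hl u List.mem_cons_self
    refine ⟨eps _ * symb (angular hπ u) * d, ?_⟩
    rw [List.map_cons, List.prod_cons, map_mul, hd]
    simp [residueMatrix, h0, nEps_zero]

lemma residueMap_units (hπ : IsUniformizer w π) (l : List Kˣ) (hl : ∀ u ∈ l, ord w u = 0) :
    residueMap hπ (l.map symb).prod = 0 := by
  obtain ⟨d, hd⟩ := residueMatrix_units hπ l hl
  simp [residueMap, hd]

lemma residueMap_uniformizer_mul_units (hπ : IsUniformizer w π) (l : List Kˣ)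
    (hl : ∀ u ∈ l, ord w u = 0) :
    residueMap hπ (symb π * (l.map symb).prod) = (l.map fun u => symb (angular hπ u)).prod := by
  obtain ⟨d, hd⟩ := residueMatrix_units hπ l hl
  have h1 : ord w π = 1 := hπ
  have h2 : angular hπ π = 1 := by
    ext
    rw [angular_val, Units.val_one, ← map_one (IsLocalRing.residue _)]
    congr 1
    ext
    simp [h1]
  have h3 : nEps (IsLocalRing.ResidueField w.valuationSubring) 1 = 1 := by simp [nEps]
  simp only [residueMap, AddMonoidHom.coe_mk, ZeroHom.coe_mk, map_mul, hd]
  simp [residueMatrix, h1, h2, h3, angle_one]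

lemma rank_residueMatrix (hπ : IsUniformizer w π) (x : KMW K) (q : Additive Kˣ × ℤ) :
    ![(truncation K x q).2, ord w (truncation K x q).1.toMul] =
      (rank.mapMatrix (residueMatrix (ord w) (angular hπ) (angular_neg_one hπ) (ord_mul w)
        (angular_steinberg hπ) x)).mulVec ![q.2, ord w q.1.toMul] := by
  have h1 : ord w 1 = 0 := ord_eq w (by simp)
  let f : Additive Kˣ →+ ℤ :=
    { toFun := fun a => ord w a.toMul, map_zero' := h1, map_add' := fun a b => ord_mul w _ _ }
  have hf : ∀ a : Additive Kˣ, ord w a.toMul = f a := fun _ => rfl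
  simp only [hf]
  induction x using induction generalizing q with
  | hz n =>
    simp only [map_intCast]
    rw [← zsmul_one n, ← zsmul_one n]
    ext i
    fin_cases i <;> simp [Matrix.mulVec, dotProduct, Fin.sum_univ_two]
  | hs a =>
    have r1 : ∀ b, rank (symb b : KMW (IsLocalRing.ResidueField w.valuationSubring)) = 0 :=
      fun b => lift_symb _ _ _ _ _ _ b
    have e : rank (nEps (IsLocalRing.ResidueField w.valuationSubring) (ord w a)
        * angle (angular hπ a)) = ord w a := by
      simp only [nEps, angle, hyp, map_mul, map_add, map_zsmul, map_one, map_ofNat, r1, mul_zero,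
        add_zero, smul_eq_mul, mul_one]
      omega
    ext i
    fin_cases i
    · simp [Matrix.mulVec, dotProduct, Fin.sum_univ_two, truncation, residueMatrix, r1]
    · simp only [Fin.mk_one, Matrix.mulVec, dotProduct, Fin.sum_univ_two, truncation, residueMatrix,
        lift_symb, RingHom.mapMatrix_apply, Matrix.map_apply]
      simp [e, r1, eps]
      rw [mul_comm]; rfl
  | he =>
    ext i
    fin_cases i <;>
      simp [Matrix.mulVec, dotProduct, Fin.sum_univ_two, truncation, residueMatrix, rank]
  | hm x y hx hy => rw [map_mul, Module.End.mul_apply, hx, hy, Matrix.mulVec_mulVec, ← map_mul,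
      ← map_mul]
  | ha x y hx hy =>
    rw [map_add, map_add, map_add, Matrix.add_mulVec, ← hx, ← hy]
    simp

/-- The rank of the residue is the order of the projection to Milnor K-theory. -/
lemma rank_residueMap (hπ : IsUniformizer w π) (x : K1 K) :
    rank (residueMap hπ x) = ord w (proj x).toMul := by
  have h1 : ord w 1 = 0 := ord_eq w (by simp)
  have := congrFun (rank_residueMatrix hπ (x : KMW K) (0, 1)) 1
  simp [Matrix.mulVec, dotProduct, Fin.sum_univ_two, h1] at this
  exact this.symm

end valuation

/-! ## The Witt ring and the fundamental ideal -/

section Witt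

variable (F : Type u) [Field F]

/-- The elements of `ℤ[Fˣ]` that vanish in the Witt ring: differences of diagonal quadratic forms
which are isometric, and the hyperbolic plane `⟨1⟩ + ⟨-1⟩`. -/
def wittRelations : Set (MonoidAlgebra ℤ Fˣ) :=
  {x | ∃ (n : ℕ) (a b : Fin n → Fˣ),
      (QuadraticMap.weightedSumSquares F a).Equivalent (QuadraticMap.weightedSumSquares F b) ∧
      x = ∑ i, MonoidAlgebra.of ℤ Fˣ (a i) - ∑ i, MonoidAlgebra.of ℤ Fˣ (b i)} ∪
  {MonoidAlgebra.of ℤ Fˣ 1 + MonoidAlgebra.of ℤ Fˣ (-1)}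

/-- The Witt ring of a field of characteristic different from `2`: the Grothendieck ring of isometry
classes of nondegenerate quadratic forms (all of which are diagonalizable, with
`⟨a⟩ ⊗ ⟨b⟩ = ⟨ab⟩`), modulo the hyperbolic plane. -/
def WittRing : Type u := MonoidAlgebra ℤ Fˣ ⧸ Ideal.span (wittRelations F)

instance : CommRing (WittRing F) :=
  inferInstanceAs (CommRing (MonoidAlgebra ℤ Fˣ ⧸ Ideal.span (wittRelations F)))

variable {F} in
/-- The class `⟨a⟩` of the one-dimensional form `a x²`. -/
def oneDim (a : Fˣ) : WittRing F :=
  Ideal.Quotient.mk (Ideal.span (wittRelations F)) (MonoidAlgebra.of ℤ Fˣ a)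

/-- The dimension modulo `2` of a Witt class. -/
def dimMod2 : WittRing F →+* ZMod 2 :=
  Ideal.Quotient.lift (Ideal.span (wittRelations F)) (MonoidAlgebra.lift ℤ (ZMod 2) Fˣ 1).toRingHom (by
    intro x hx
    have : Ideal.span (wittRelations F)
        ≤ RingHom.ker (MonoidAlgebra.lift ℤ (ZMod 2) Fˣ 1).toRingHom := by
      rw [Ideal.span_le]
      rintro y (⟨n, a, b, -, rfl⟩ | rfl)
      · simp [RingHom.mem_ker]
      · simp [RingHom.mem_ker]; decide
    exact this hx)

/-- The fundamental ideal `I(F)`: the classes of the even-dimensional forms. -/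
def fundamentalIdeal : Ideal (WittRing F) := RingHom.ker (dimMod2 F)

variable {F} in
/-- The Pfister form `⟨⟨a⟩⟩ = ⟨1⟩ - ⟨a⟩`. -/
def pfister (a : Fˣ) : WittRing F := oneDim 1 - oneDim a

variable {F} in
lemma pfister_mem (a : Fˣ) : pfister a ∈ fundamentalIdeal F := by
  have h : ∀ c : Fˣ, dimMod2 F (oneDim c) = 1 := fun c =>
    (Ideal.Quotient.lift_mk _ _ _).trans (by simp)
  rw [fundamentalIdeal, RingHom.mem_ker, pfister, map_sub, h, h, sub_self]

/-- The square `I²(F)` of the fundamental ideal. -/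
abbrev ISq : Ideal (WittRing F) := fundamentalIdeal F ^ 2

variable {F} in
/-- The two-fold Pfister form `⟨⟨a, b⟩⟩ = ⟨⟨a⟩⟩⟨⟨b⟩⟩` as an element of `I²(F)`. -/
def pfister₂ (a b : Fˣ) : ISq F :=
  ⟨pfister a * pfister b, by
    rw [ISq, pow_two]; exact Ideal.mul_mem_mul (pfister_mem a) (pfister_mem b)⟩

end Witt

/-! ## Places of a number field -/

section places

variable (F : Type u) [Field F] [NumberField F]

/-- The places of a number field: the infinite ones and the finite ones. -/
abbrev Place : Type u := InfinitePlace F ⊕ HeightOneSpectrum (𝓞 F)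

variable {F}

/-- The completion `F_v`. -/
def Place.Completion : Place F → Type u
  | .inl v => v.Completion
  | .inr v => v.adicCompletion F

instance (v : Place F) : Field v.Completion :=
  match v with
  | .inl v => inferInstanceAs (Field v.Completion)
  | .inr v => inferInstanceAs (Field (v.adicCompletion F))

/-- The signature homomorphism `K^MW_*(F_v) → ℤ` at a real place: the composite of
`[a_1, …, a_n] ↦ ⟨⟨a_1, …, a_n⟩⟩`, `η ↦ -1`, with the signature of quadratic forms over `F_v = ℝ`.
Thus `[a] ↦ 1 - sign a`. -/
def signature (v : InfinitePlace F) (hv : v.IsReal) : KMW v.Completion →+* ℤ :=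
  lift (F := v.Completion)
    (fun a => 1 - ((SignType.sign (InfinitePlace.Completion.extensionEmbeddingOfIsReal hv a) :
      SignType) : ℤ)) (-1)
    (by
      intro a b h
      have h' := congrArg (InfinitePlace.Completion.extensionEmbeddingOfIsReal hv) h
      rw [map_add, map_one] at h'
      rcases lt_or_ge 0 (InfinitePlace.Completion.extensionEmbeddingOfIsReal hv a) with ha | ha
      · rw [sign_pos ha]; simp
      · rw [sign_pos (show 0 < InfinitePlace.Completion.extensionEmbeddingOfIsReal hv b by linarith)]
        simp)
    (by
      intro a b
      simp only [Units.val_mul, map_mul, sign_mul, SignType.coe_mul]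
      ring)
    (by intro a; ring)
    (by
      rw [Units.val_neg, Units.val_one, map_neg, map_one, sign_neg (by norm_num)]
      norm_num)

/-- The group `O_v^×` of units: the units of the valuation ring at a finite place, the positive
elements at a real place and everything at a complex place. -/
def integralUnits : (v : Place F) → Subgroup (v.Completion)ˣ
  | .inl v =>
    ⨅ hv : v.IsReal, (Units.posSubgroup ℝ).comap
      (Units.map (InfinitePlace.Completion.extensionEmbeddingOfIsReal hv).toMonoidHom)
  | .inr v => (v.adicCompletionIntegers F).unitGroup

/-- The group `K^MW_1(O_v)`, the kernel of the residue map at a finite place (the kernel of `∂^π`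
does not depend on the uniformizer `π`), the kernel of the signature at a real place, and everything
at a complex place. -/
def integralK1 : (v : Place F) → AddSubgroup (K1 v.Completion)
  | .inl v =>
    ⨅ hv : v.IsReal, (signature v hv).toAddMonoidHom.ker.comap (K1 v.Completion).subtype
  | .inr v =>
    ⨅ (π : (v.adicCompletion F)ˣ)
      (hπ : IsUniformizer (Valued.v : Valuation (v.adicCompletion F) _) π),
      (residueMap hπ).ker.comap (K1 (v.adicCompletion F)).subtype

variable (F)

/-- The Milnor–Witt idèle group: the restricted product of the groups `K^MW_1(F_v)` with respect to
the subgroups `K^MW_1(O_v)`, i.e. the union over all finite sets `S` of places of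
`∏_{v ∈ S} K^MW_1(F_v) × ∏_{v ∉ S} K^MW_1(O_v)`. -/
abbrev MWIdele : Type u :=
  RestrictedProduct (fun v : Place F => K1 v.Completion)
    (fun v => (integralK1 v : Set (K1 v.Completion))) cofinite

/-- The classical idèle group: the restricted product of the groups `F_v^×` with respect to the
subgroups `O_v^×`. -/
abbrev Idele : Type u :=
  RestrictedProduct (fun v : Place F => (v.Completion)ˣ)
    (fun v => (integralUnits v : Set (v.Completion)ˣ)) cofinite

variable {F}

lemma proj_mem (v : HeightOneSpectrum (𝓞 F)) (x : K1 (v.adicCompletion F))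
    (hx : x ∈ integralK1 (.inr v : Place F)) :
    (proj x).toMul ∈ (v.adicCompletionIntegers F).unitGroup := by
  obtain ⟨π₀, hπ₀⟩ := v.valuation_exists_uniformizer F
  have hv : (Valued.v (π₀ : v.adicCompletion F)) = WithZero.exp (-1 : ℤ) := by
    rw [HeightOneSpectrum.valuedAdicCompletion_eq_valuation', hπ₀]
  let π : (v.adicCompletion F)ˣ := Units.mk0 (π₀ : v.adicCompletion F) (by
    intro h
    rw [h, map_zero] at hv
    exact WithZero.exp_ne_zero hv.symm)
  have hπ : IsUniformizer (Valued.v : Valuation (v.adicCompletion F) _) π := ord_eq _ hv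
  have h1 : residueMap hπ x = 0 := by
    have h2 := (AddSubgroup.mem_iInf.1 ((AddSubgroup.mem_iInf.1 hx) π)) hπ
    exact h2
  have h3 := rank_residueMap hπ x
  rw [h1, map_zero] at h3
  refine (Valuation.mem_unitGroup_iff (v.adicCompletion F) Valued.v _).2 ?_
  rw [val_eq, ← h3, neg_zero, WithZero.exp_zero]

variable (F)

/-- The projection from the Milnor–Witt idèles to the classical idèles induced by the projections
from Milnor–Witt K-theory to Milnor K-theory. -/
def ideleProj : MWIdele F →+ Additive (Idele F) where
  toFun x := Additive.ofMul ⟨fun v => (proj (x v)).toMul, by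
    have h : ∀ᶠ v : Place F in cofinite, ∃ w, v = Sum.inr w := by
      refine (Set.finite_range (Sum.inl : InfinitePlace F → Place F)).subset ?_
      rintro (v | v) hv
      · exact ⟨v, rfl⟩
      · exact absurd ⟨v, rfl⟩ hv
    filter_upwards [h, x.2] with v hv hx
    obtain ⟨w, rfl⟩ := hv
    exact proj_mem w _ hx⟩
  map_zero' := by
    apply congrArg Additive.ofMul
    ext v
    simp
  map_add' x y := by
    apply congrArg Additive.ofMul
    ext v
    simp
    rfl

end places

end MilnorWitt
end

/-!
For a field `F` of characteristic different from `2`, the kernel of `p : K^MW_1(F) → Fˣ` is the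
group `η K^MW_2(F)` spanned by the elements `η[a][b]`, because every element of `K^MW_1(F)` is a
symbol modulo this group (`exists_eq_symb_add`). The ring homomorphism `toWitt` to the Witt ring,
`[a] ↦ ⟨⟨a⟩⟩` and `η ↦ -1`, maps it onto `I²(F)`, and the homomorphism `I²(F) → K^MW_1(F)` is the
inverse of the negative of this map.

That the map is injective is `eq_zero_of_toWitt_eq_zero`. An element of `η K^MW_2(F)` is the image
of an element `X` of the group ring `ℤ[Fˣ]` under the additive map `⟨a⟩ ↦ [a]`. If `X` vanishes in
the Witt ring, it is a combination of isometry relations and hyperbolic planes. Modulo the subgroup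
of the symbols `[c²] = h[c]`, the map `⟨a⟩ ↦ [a]` respects isometries of diagonal forms: by chain
equivalence (`sum_eq_of_span_eq`) it is enough to treat binary forms, where the claim is the
Steinberg relation. So the given element is some `[c²]`; being killed by `p` it satisfies `c² = 1`,
so it is `[1] = 0`. The same argument shows that `⟨⟨a⟩⟩ = 0` only if `a` is a square.

For the idèles it remains to see that an integral element of the kernel of `p` is zero at almost
every place. At a finite place not above `2`, with uniformizer `π`, the form `⟨⟨a, b⟩⟩` vanishes for
units `a` and `b`, since `⟨a, b⟩` represents `1` over the finite residue field, hence over `F_v` by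
Hensel's lemma. It follows that every element of `I²(F_v)` is of the form `⟨⟨π, b⟩⟩` for a unit `b`,
so every element of the kernel of `p` is some `η[π][b]`. Its residue is `η` times the symbol of the
residue class of `b`, and if this vanishes, then `b` is a square in the residue field, hence in
`F_v`, and `η[π][b] = 0` (`IsOddLocal.eq_zero_of_residueMap`).
-/

noncomputable section

namespace MilnorWitt

universe u

/-! ### Invariants of orthogonal bases -/

section OrthogonalBases

variable {K : Type*} [Field K] {V : Type*} [AddCommGroup V] [Module K V]
  {B : V →ₗ[K] V →ₗ[K] K} {A : Type*} [AddCommGroup A] {g : K → A}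

/-- A family of pairwise orthogonal anisotropic vectors. -/
def IsAnisotropicFamily {ι : Type*} (B : V →ₗ[K] V →ₗ[K] K) (e : ι → V) : Prop :=
  (∀ i j, i ≠ j → B (e i) (e j) = 0) ∧ ∀ i, B (e i) (e i) ≠ 0

/-- A function on the values of a form which is constant on square classes and compatible with
changing the diagonalization of a binary form, `⟨a, b⟩ ≅ ⟨a + b, ab(a + b)⟩`. -/
structure IsBinaryInvariant (g : K → A) : Prop where
  mul_sq : ∀ a c, a ≠ 0 → c ≠ 0 → g (a * c ^ 2) = g a
  binary : ∀ a b, a ≠ 0 → b ≠ 0 → a + b ≠ 0 → g a + g b = g (a + b) + g (a * b * (a + b))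

/-- In an orthogonal family, two vectors `e i` and `e j` can be replaced by `x • e i + y • e j` and
the vector orthogonal to it in their plane. -/
lemma exists_replace_pair {ι : Type*} [Fintype ι] (hB : ∀ v w, B v w = B w v)
    (hg : IsBinaryInvariant g) {e : ι → V} (he : IsAnisotropicFamily B e) {i j : ι} (hij : i ≠ j)
    {x y : K} (hx : x ≠ 0) (hy : y ≠ 0)
    (hc : x ^ 2 * B (e i) (e i) + y ^ 2 * B (e j) (e j) ≠ 0) :
    ∃ e' : ι → V, IsAnisotropicFamily B e' ∧ e' i = x • e i + y • e j ∧
      (∀ k, k ≠ i → k ≠ j → e' k = e k) ∧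
      Submodule.span K (Set.range e') = Submodule.span K (Set.range e) ∧
      ∑ k, g (B (e' k) (e' k)) = ∑ k, g (B (e k) (e k)) := by
  classical
  set a := B (e i) (e i) with ha
  set b := B (e j) (e j) with hb
  have ha0 : a ≠ 0 := he.2 i
  have hb0 : b ≠ 0 := he.2 j
  have hij0 : B (e i) (e j) = 0 := he.1 i j hij
  have hji0 : B (e j) (e i) = 0 := he.1 j i hij.symm
  set p := x • e i + y • e j with hp
  set r := (y * b) • e i - (x * a) • e j with hr
  have hpp : B p p = x ^ 2 * a + y ^ 2 * b := by
    simp only [hp, map_add, map_smul, LinearMap.add_apply, LinearMap.smul_apply, smul_eq_mul, hij0,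
      hji0, ← ha, ← hb]
    ring
  have hrr : B r r = a * b * (x ^ 2 * a + y ^ 2 * b) := by
    simp only [hr, map_sub, map_smul, LinearMap.sub_apply, LinearMap.smul_apply, smul_eq_mul, hij0,
      hji0, ← ha, ← hb]
    ring
  have hpr : B p r = 0 := by
    simp only [hp, hr, map_add, map_sub, map_smul, LinearMap.add_apply,
      LinearMap.smul_apply, smul_eq_mul, hij0, hji0, ← ha, ← hb]
    ring
  have hk : ∀ k, k ≠ i → k ≠ j → B p (e k) = 0 ∧ B r (e k) = 0 := fun k hki hkj => by
    simp [hp, hr, he.1 i k hki.symm, he.1 j k hkj.symm]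
  let e' : ι → V := fun k => if k = i then p else if k = j then r else e k
  have ei : e' i = p := if_pos rfl
  have ej : e' j = r := by simp [e', hij.symm]
  have ek : ∀ k, k ≠ i → k ≠ j → e' k = e k := fun k h1 h2 => by simp [e', h1, h2]
  refine ⟨e', ⟨fun k l hkl => ?_, fun k => ?_⟩, ei, ek, le_antisymm ?_ ?_, ?_⟩
  · by_cases h1 : k = i
    · subst h1
      by_cases h2 : l = j
      · subst h2; rw [ei, ej, hpr]
      · rw [ei, ek l hkl.symm h2, (hk l hkl.symm h2).1]
    by_cases h2 : k = j
    · subst h2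
      by_cases h3 : l = i
      · subst h3; rw [ei, ej, hB, hpr]
      · rw [ej, ek l h3 hkl.symm, (hk l h3 hkl.symm).2]
    rw [ek k h1 h2]
    by_cases h3 : l = i
    · subst h3; rw [ei, hB, (hk k h1 h2).1]
    by_cases h4 : l = j
    · subst h4; rw [ej, hB, (hk k h1 h2).2]
    rw [ek l h3 h4, he.1 k l hkl]
  · by_cases h1 : k = i
    · subst h1; rw [ei, hpp]; exact hc
    by_cases h2 : k = j
    · subst h2; rw [ej, hrr]; exact mul_ne_zero (mul_ne_zero ha0 hb0) hc
    rw [ek k h1 h2]; exact he.2 k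
  · rw [Submodule.span_le]
    rintro _ ⟨k, rfl⟩
    have hmem : ∀ l, e l ∈ Submodule.span K (Set.range e) := fun l =>
      Submodule.subset_span ⟨l, rfl⟩
    by_cases h1 : k = i
    · subst h1; rw [ei]
      exact add_mem (Submodule.smul_mem _ _ (hmem _)) (Submodule.smul_mem _ _ (hmem _))
    by_cases h2 : k = j
    · subst h2; rw [ej]
      exact sub_mem (Submodule.smul_mem _ _ (hmem _)) (Submodule.smul_mem _ _ (hmem _))
    rw [ek k h1 h2]; exact hmem k
  · rw [Submodule.span_le]
    rintro _ ⟨k, rfl⟩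
    have hmem : ∀ l, e' l ∈ Submodule.span K (Set.range e') := fun l =>
      Submodule.subset_span ⟨l, rfl⟩
    have hpm := hmem i
    have hrm := hmem j
    rw [ei] at hpm
    rw [ej] at hrm
    by_cases h1 : k = i
    · subst h1
      have : e k = (x ^ 2 * a + y ^ 2 * b)⁻¹ • ((x * a) • p + y • r) := by
        rw [eq_inv_smul_iff₀ hc, hp, hr]
        module
      rw [this]
      exact Submodule.smul_mem _ _
        (add_mem (Submodule.smul_mem _ _ hpm) (Submodule.smul_mem _ _ hrm))
    by_cases h2 : k = j
    · subst h2
      have : e k = (x ^ 2 * a + y ^ 2 * b)⁻¹ • ((y * b) • p - x • r) := by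
        rw [eq_inv_smul_iff₀ hc, hp, hr]
        module
      rw [this]
      exact Submodule.smul_mem _ _
        (sub_mem (Submodule.smul_mem _ _ hpm) (Submodule.smul_mem _ _ hrm))
    rw [← ek k h1 h2]; exact hmem k
  · rw [← sub_eq_zero, ← Finset.sum_sub_distrib,
      Finset.sum_eq_add i j hij (fun k _ hk => by rw [ek k hk.1 hk.2, sub_self]) (by simp) (by simp),
      ei, ej, hpp, hrr, ← ha, ← hb]
    have h := hg.binary (a * x ^ 2) (b * y ^ 2) (mul_ne_zero ha0 (pow_ne_zero 2 hx))
      (mul_ne_zero hb0 (pow_ne_zero 2 hy)) (by rwa [mul_comm a, mul_comm b])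
    rw [hg.mul_sq a x ha0 hx, hg.mul_sq b y hb0 hy, show a * x ^ 2 * (b * y ^ 2) *
      (a * x ^ 2 + b * y ^ 2) = a * b * (x ^ 2 * a + y ^ 2 * b) * (x * y) ^ 2 by ring,
      hg.mul_sq _ _ (mul_ne_zero (mul_ne_zero ha0 hb0) hc) (mul_ne_zero hx hy),
      mul_comm a (x ^ 2), mul_comm b (y ^ 2)] at h
    have h' : g a = g (x ^ 2 * a + y ^ 2 * b) + g (a * b * (x ^ 2 * a + y ^ 2 * b)) - g b :=
      eq_sub_of_add_eq h
    rw [h']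
    abel

/-- Every anisotropic vector in the span of an orthogonal family belongs to an orthogonal family
with the same span and the same invariant. -/
lemma exists_family_through {ι : Type*} [Fintype ι] (h2 : (2 : K) ≠ 0)
    (hB : ∀ v w, B v w = B w v) (hg : IsBinaryInvariant g) (s : Finset ι) (hs : s.Nonempty)
    (e : ι → V) (he : IsAnisotropicFamily B e) (x : ι → K) (hx : ∀ i ∈ s, x i ≠ 0)
    (hw : B (∑ i ∈ s, x i • e i) (∑ i ∈ s, x i • e i) ≠ 0) :
    ∃ (e' : ι → V) (i₀ : ι), IsAnisotropicFamily B e' ∧ e' i₀ = ∑ i ∈ s, x i • e i ∧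
      Submodule.span K (Set.range e') = Submodule.span K (Set.range e) ∧
      ∑ k, g (B (e' k) (e' k)) = ∑ k, g (B (e k) (e k)) := by
  classical
  induction hn : s.card using Nat.strong_induction_on generalizing s e x with
  | _ n ih =>
  obtain ⟨i, rfl⟩ | hnt := hs.exists_eq_singleton_or_nontrivial
  · have hxi : x i ≠ 0 := hx i (by simp)
    rw [Finset.sum_singleton] at hw ⊢
    refine ⟨Function.update e i (x i • e i), i, ⟨fun k l hkl => ?_, fun k => ?_⟩, by simp,
      le_antisymm ?_ ?_, ?_⟩
    · by_cases h1 : k = i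
      · subst h1
        simp [Function.update_of_ne hkl.symm, he.1 k l hkl]
      by_cases h3 : l = i
      · subst h3
        simp [Function.update_of_ne hkl, he.1 k l hkl]
      rw [Function.update_of_ne h1, Function.update_of_ne h3, he.1 k l hkl]
    · by_cases h1 : k = i
      · subst h1; simpa using hw
      · rw [Function.update_of_ne h1]; exact he.2 k
    · rw [Submodule.span_le]
      rintro _ ⟨k, rfl⟩
      by_cases h1 : k = i
      · subst h1
        rw [Function.update_self]
        exact Submodule.smul_mem _ _ (Submodule.subset_span ⟨k, rfl⟩)
      · rw [Function.update_of_ne h1]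
        exact Submodule.subset_span ⟨k, rfl⟩
    · rw [Submodule.span_le]
      rintro _ ⟨k, rfl⟩
      by_cases h1 : k = i
      · subst h1
        have h : Function.update e k (x k • e k) k
            ∈ Submodule.span K (Set.range (Function.update e k (x k • e k))) :=
          Submodule.subset_span ⟨k, rfl⟩
        rw [Function.update_self] at h
        exact (Submodule.smul_mem_iff _ hxi).1 h
      · rw [← Function.update_of_ne h1 (x i • e i) e]
        exact Submodule.subset_span ⟨k, rfl⟩
    · refine Finset.sum_congr rfl fun k _ => ?_
      by_cases h1 : k = i
      · subst h1
        rw [Function.update_self, ← hg.mul_sq _ (x k) (he.2 k) hxi]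
        congr 1
        simp only [map_smul, LinearMap.smul_apply, smul_eq_mul]
        ring
      · rw [Function.update_of_ne h1]
  · -- Some pair in the support spans an anisotropic partial sum.
    obtain ⟨i, hi, j, hj, hij, hc⟩ : ∃ i ∈ s, ∃ j ∈ s, i ≠ j ∧
        x i ^ 2 * B (e i) (e i) + x j ^ 2 * B (e j) (e j) ≠ 0 := by
      by_contra! hcon
      obtain ⟨i, hi, j, hj, hij⟩ := hnt
      by_cases h3 : ∃ k ∈ s, k ≠ i ∧ k ≠ j
      · obtain ⟨k, hk, hki, hkj⟩ := h3
        have e1 := hcon i hi j hj hij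
        have e2 := hcon i hi k hk hki.symm
        have e3 := hcon j hj k hk hkj.symm
        have : (2 : K) * (x i ^ 2 * B (e i) (e i)) = 0 := by linear_combination e1 + e2 - e3
        exact mul_ne_zero h2 (mul_ne_zero (pow_ne_zero 2 (hx i hi)) (he.2 i)) this
      · push Not at h3
        have hs2 : s = {i, j} := by
          ext k
          simp only [Finset.mem_insert, Finset.mem_singleton]
          refine ⟨fun hk => ?_, ?_⟩
          · by_contra! h
            exact h.2 (h3 k hk h.1)
          · rintro (rfl | rfl) <;> assumption
        apply hw
        rw [hs2, Finset.sum_pair hij, ← hcon i hi j hj hij]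
        simp only [map_add, map_smul, LinearMap.add_apply, LinearMap.smul_apply, smul_eq_mul,
          he.1 i j hij, he.1 j i hij.symm]
        ring
    obtain ⟨e', he', hei, hek, hspan, hsum⟩ :=
      exists_replace_pair hB hg he hij (hx i hi) (hx j hj) hc
    have hsame : ∑ k ∈ s.erase j, Function.update x i 1 k • e' k = ∑ k ∈ s, x k • e k := by
      have hi' : i ∈ s.erase j := Finset.mem_erase.2 ⟨hij, hi⟩
      rw [← Finset.add_sum_erase _ _ hi', ← Finset.add_sum_erase s _ hj,
        ← Finset.add_sum_erase (s.erase j) (fun k => x k • e k) hi', Function.update_self, one_smul,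
        hei]
      have : ∑ k ∈ (s.erase j).erase i, Function.update x i 1 k • e' k
          = ∑ k ∈ (s.erase j).erase i, x k • e k := by
        refine Finset.sum_congr rfl fun k hk => ?_
        simp only [Finset.mem_erase] at hk
        rw [Function.update_of_ne hk.1, hek k hk.1 hk.2.1]
      rw [this]
      abel
    obtain ⟨e'', i₀, h1, h3, h4, h5⟩ := ih (s.erase j).card
      (by rw [← hn]; exact Finset.card_erase_lt_of_mem hj) (s.erase j)
      ⟨i, Finset.mem_erase.2 ⟨hij, hi⟩⟩ e' he' (Function.update x i 1)
      (fun k hk => by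
        by_cases h1 : k = i
        · subst h1; simp
        · rw [Function.update_of_ne h1]; exact hx k (Finset.mem_of_mem_erase hk))
      (by rwa [hsame]) rfl
    exact ⟨e'', i₀, h1, h3.trans hsame, h4.trans hspan, h5.trans hsum⟩

/-- Both tails span the orthogonal complement of the common first vector. -/
lemma span_tail_le {n : ℕ} {e f : Fin (n + 1) → V} (he : IsAnisotropicFamily B e)
    (hf : IsAnisotropicFamily B f) (h0 : e 0 = f 0)
    (hspan : Submodule.span K (Set.range f) ≤ Submodule.span K (Set.range e)) :
    Submodule.span K (Set.range fun k : Fin n => f k.succ)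
      ≤ Submodule.span K (Set.range fun k : Fin n => e k.succ) := by
  rw [Submodule.span_le]
  rintro _ ⟨k, rfl⟩
  have hmem : f k.succ ∈ Submodule.span K (Set.range e) :=
    hspan (Submodule.subset_span ⟨_, rfl⟩)
  obtain ⟨y, hy⟩ := (Submodule.mem_span_range_iff_exists_fun K).1 hmem
  have h1 : B (e 0) (f k.succ) = 0 := by rw [h0]; exact hf.1 _ _ (Fin.succ_ne_zero k).symm
  rw [← hy, map_sum, Finset.sum_eq_single 0 (fun i _ hi => by rw [map_smul, he.1 0 i hi.symm,
    smul_zero]) (by simp), map_smul, smul_eq_mul] at h1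
  have hy0 : y 0 = 0 := (mul_eq_zero.1 h1).resolve_right (he.2 0)
  rw [Fin.sum_univ_succ, hy0, zero_smul, zero_add] at hy
  change f k.succ ∈ _
  rw [← hy]
  exact sum_mem fun i _ => Submodule.smul_mem _ _ (Submodule.subset_span ⟨i, rfl⟩)

/-- An invariant of binary diagonal forms is an invariant of all diagonal forms. This is Witt's
chain equivalence theorem, stated for two orthogonal bases of one space so that no cancellation
theorem is needed. -/
theorem sum_eq_of_span_eq (h2 : (2 : K) ≠ 0) (hB : ∀ v w, B v w = B w v)
    (hg : IsBinaryInvariant g) {n : ℕ} {e f : Fin n → V} (he : IsAnisotropicFamily B e)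
    (hf : IsAnisotropicFamily B f)
    (hspan : Submodule.span K (Set.range e) = Submodule.span K (Set.range f)) :
    ∑ k, g (B (e k) (e k)) = ∑ k, g (B (f k) (f k)) := by
  classical
  induction n with
  | zero => simp
  | succ n ih =>
    have hmem : f 0 ∈ Submodule.span K (Set.range e) := by
      rw [hspan]; exact Submodule.subset_span ⟨0, rfl⟩
    obtain ⟨x, hx⟩ := (Submodule.mem_span_range_iff_exists_fun K).1 hmem
    have hx' : ∑ i with x i ≠ 0, x i • e i = f 0 := by
      rw [← hx, Finset.sum_filter_of_ne]
      intro i _ hi h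
      exact hi (by rw [h, zero_smul])
    have hne : (Finset.univ.filter fun i => x i ≠ 0).Nonempty := by
      rw [Finset.nonempty_iff_ne_empty]
      intro h
      rw [h, Finset.sum_empty] at hx'
      exact hf.2 0 (by rw [← hx', map_zero])
    obtain ⟨e', i₀, h1, h3, h4, h5⟩ := exists_family_through h2 hB hg _ hne e he x (by simp)
      (by rw [hx']; exact hf.2 0)
    rw [hx'] at h3
    let σ := Equiv.swap 0 i₀
    let e'' := e' ∘ σ
    have he'' : IsAnisotropicFamily B e'' :=
      ⟨fun i j hij => h1.1 _ _ (σ.injective.ne hij), fun i => h1.2 _⟩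
    have h0 : e'' 0 = f 0 := by simp [e'', σ, h3]
    have hspan'' : Submodule.span K (Set.range e'') = Submodule.span K (Set.range f) := by
      rw [← hspan, ← h4, σ.surjective.range_comp]
    have hsum : ∑ k, g (B (e'' k) (e'' k)) = ∑ k, g (B (e k) (e k)) := by
      rw [← h5]
      exact Equiv.sum_comp σ fun k => g (B (e' k) (e' k))
    have htail := ih (e := fun k => e'' k.succ) (f := fun k => f k.succ)
      ⟨fun i j hij => he''.1 _ _ ((Fin.succ_injective n).ne hij), fun i => he''.2 _⟩
      ⟨fun i j hij => hf.1 _ _ ((Fin.succ_injective n).ne hij), fun i => hf.2 _⟩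
      (le_antisymm (span_tail_le hf he'' h0.symm hspan''.le)
        (span_tail_le he'' hf h0 hspan''.ge))
    rw [← hsum, Fin.sum_univ_succ, Fin.sum_univ_succ, htail, h0]

/-- An invariant of binary diagonal forms takes the same value on isometric diagonal forms. -/
theorem sum_eq_of_equivalent (h2 : (2 : K) ≠ 0) (hg : IsBinaryInvariant g) {n : ℕ}
    {a b : Fin n → Kˣ}
    (h : (QuadraticMap.weightedSumSquares K a).Equivalent (QuadraticMap.weightedSumSquares K b)) :
    ∑ i, g (a i) = ∑ i, g (b i) := by
  classical
  have : Invertible (2 : K) := invertibleOfNonzero h2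
  obtain ⟨φ⟩ := h
  have hq : ∀ (c : Fin n → Kˣ) (i : Fin n),
      QuadraticMap.weightedSumSquares K c (Pi.single i 1) = c i := fun c i => by
    rw [QuadraticMap.weightedSumSquares_apply, Finset.sum_eq_single i]
    · simp [Units.smul_def]
    · intro j _ hj; simp [hj]
    · simp
  have hp : ∀ (c : Fin n → Kˣ) (i j : Fin n), i ≠ j →
      QuadraticMap.polar (QuadraticMap.weightedSumSquares K c) (Pi.single i 1) (Pi.single j 1)
        = 0 := fun c i j hij => by
    rw [QuadraticMap.polar, hq, hq, QuadraticMap.weightedSumSquares_apply,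
      Finset.sum_eq_add i j hij]
    · simp [hij, hij.symm, Units.smul_def]
    · intro k _ hk; simp [hk.1, hk.2]
    · simp
    · simp
  set Q := QuadraticMap.weightedSumSquares K a
  set R := QuadraticMap.weightedSumSquares K b
  have hself : ∀ v, QuadraticMap.associated Q v v = Q v := fun v =>
    QuadraticMap.associated_eq_self_apply K Q v
  have hzero : ∀ v w, QuadraticMap.polar Q v w = 0 → QuadraticMap.associated Q v w = 0 :=
    fun v w h => by
      rw [QuadraticMap.associated_apply]
      rw [QuadraticMap.polar] at h
      rw [h, smul_zero]
  have hsymm : ∀ x, Q (φ.symm x) = R x := fun x => φ.symm.map_app x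
  let e : Fin n → Fin n → K := fun i => Pi.single i 1
  let f : Fin n → Fin n → K := fun i => φ.symm (Pi.single i 1)
  have htop : Submodule.span K (Set.range e) = ⊤ := by
    have := (Pi.basisFun K (Fin n)).span_eq
    rwa [show ⇑(Pi.basisFun K (Fin n)) = e from funext fun i => Pi.basisFun_apply K (Fin n) i]
      at this
  have htop' : Submodule.span K (Set.range f) = ⊤ := by
    have h1 : Set.range f = φ.symm.toLinearEquiv '' Set.range e := by
      rw [← Set.range_comp]; rfl
    rw [h1, ← LinearEquiv.coe_coe, Submodule.span_image, htop, Submodule.map_top,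
      LinearEquiv.range]
  have he : IsAnisotropicFamily (QuadraticMap.associated Q) e :=
    ⟨fun i j hij => hzero _ _ (hp a i j hij), fun i => by
      rw [hself, hq]; exact (a i).ne_zero⟩
  have hf : IsAnisotropicFamily (QuadraticMap.associated Q) f :=
    ⟨fun i j hij => hzero _ _ (by
      rw [QuadraticMap.polar, ← map_add φ.symm, hsymm, hsymm, hsymm]
      exact hp b i j hij), fun i => by
      rw [hself, hsymm, hq]; exact (b i).ne_zero⟩
  have := sum_eq_of_span_eq h2 (QuadraticMap.associated_isSymm K Q) hg he hf
    (htop.trans htop'.symm)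
  simp only [hself, e, f, hsymm] at this
  simpa only [Q, R, hq] using this

end OrthogonalBases

/-! ### The kernel of the projection to Milnor K-theory -/

section Kernel

variable {F : Type u} [Field F]

variable (F) in
/-- The additive group `η K^MW_2(F)`, spanned by the elements `η[a][b]`. -/
def etaK2 : AddSubgroup (KMW F) :=
  AddSubgroup.closure {x | ∃ a b : Fˣ, x = eta F * symb a * symb b}

lemma eta_symb_symb_mem (a b : Fˣ) : eta F * symb a * symb b ∈ etaK2 F :=
  AddSubgroup.subset_closure ⟨a, b, rfl⟩

lemma eta_mul_symb_mul_mem (a : Fˣ) {x : KMW F} (hx : x ∈ etaK2 F) :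
    eta F * symb a * x ∈ etaK2 F := by
  induction hx using AddSubgroup.closure_induction with
  | mem x hx =>
    obtain ⟨b, c, rfl⟩ := hx
    have h : eta F * symb b * symb c = symb (b * c) - symb b - symb c := by
      rw [symb_mul]; abel
    rw [h, mul_sub, mul_sub]
    exact sub_mem (sub_mem (eta_symb_symb_mem _ _) (eta_symb_symb_mem _ _))
      (eta_symb_symb_mem _ _)
  | zero => rw [mul_zero]; exact zero_mem _
  | add x y _ _ hx hy => rw [mul_add]; exact add_mem hx hy
  | neg x _ hx => rw [mul_neg]; exact neg_mem hx

/-- A word in the generators is a power of `η` times a product of symbols. -/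
lemma exists_word_normal_form (w : List (Gen F)) : ∃ (m : ℕ) (l : List Fˣ),
    (w.map Gen.deg).sum = l.length - m ∧
      (w.map gen).prod = eta F ^ m * (l.map symb).prod := by
  induction w with
  | nil => exact ⟨0, [], by simp, by simp⟩
  | cons g w ih =>
    obtain ⟨m, l, hd, hw⟩ := ih
    cases g with
    | symb a =>
      refine ⟨m, a :: l, ?_, ?_⟩
      · simp [Gen.deg, hd]; ring
      · have h : symb a * eta F ^ m = eta F ^ m * symb a :=
          (Commute.pow_right (eta_comm a).symm m)
        simp only [List.map_cons, List.prod_cons, hw]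
        rw [← mul_assoc, ← mul_assoc, ← h]
        rfl
    | eta =>
      refine ⟨m + 1, l, ?_, ?_⟩
      · simp [Gen.deg, hd]; ring
      · simp only [List.map_cons, List.prod_cons, hw, pow_succ']
        rw [mul_assoc]
        rfl

/-- The normal forms of degree one, `η ^ (n - 1) [a_1] ⋯ [a_n]`, are symbols modulo `η K^MW_2(F)`;
for `n ≥ 2` they lie in `η K^MW_2(F)`, because `η[b][c] = [bc] - [b] - [c]`. -/
lemma exists_eq_symb_add_of_word (a : Fˣ) (l : List Fˣ) :
    ∃ (b : Fˣ) (n : KMW F), n ∈ etaK2 F ∧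
      eta F ^ l.length * ((a :: l).map symb).prod = symb b + n := by
  induction l generalizing a with
  | nil => exact ⟨a, 0, zero_mem _, by simp⟩
  | cons c l ih =>
    obtain ⟨b, n, hn, h⟩ := ih c
    refine ⟨1, eta F * symb a * (symb b + n), ?_, ?_⟩
    · rw [mul_add]
      exact add_mem (eta_symb_symb_mem _ _) (eta_mul_symb_mul_mem _ hn)
    · rw [symb_one, zero_add, ← h, List.map_cons (a := a), List.prod_cons, List.length_cons, pow_succ']
      have h' : symb a * eta F ^ l.length = eta F ^ l.length * symb a :=
        (Commute.pow_right (eta_comm a).symm _)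
      simp only [mul_assoc]
      rw [← mul_assoc (symb a), h', mul_assoc]

/-- Every element of `K^MW_1(F)` is a symbol modulo `η K^MW_2(F)`. -/
lemma exists_eq_symb_add {x : KMW F} (hx : x ∈ K1 F) :
    ∃ (a : Fˣ) (n : KMW F), n ∈ etaK2 F ∧ x = symb a + n := by
  induction hx using AddSubgroup.closure_induction with
  | mem x hx =>
    obtain ⟨w, hw, rfl⟩ := hx
    obtain ⟨m, l, hd, h⟩ := exists_word_normal_form w
    cases l with
    | nil =>
      simp only [List.length_nil] at hd
      omega
    | cons a l =>
      have hm : m = l.length := by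
        simp only [List.length_cons] at hd
        omega
      obtain ⟨b, n, hn, h'⟩ := exists_eq_symb_add_of_word a l
      exact ⟨b, n, hn, by rw [h, hm, h']⟩
  | zero => exact ⟨1, 0, zero_mem _, by rw [symb_one, add_zero]⟩
  | add x y _ _ hx hy =>
    obtain ⟨a, m, hm, rfl⟩ := hx
    obtain ⟨b, n, hn, rfl⟩ := hy
    refine ⟨a * b, m + n - eta F * symb a * symb b,
      sub_mem (add_mem hm hn) (eta_symb_symb_mem _ _), ?_⟩
    rw [symb_mul]; abel
  | neg x _ hx =>
    obtain ⟨a, m, hm, rfl⟩ := hx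
    refine ⟨a⁻¹, eta F * symb a * symb a⁻¹ - m, sub_mem (eta_symb_symb_mem _ _) hm, ?_⟩
    have h := symb_mul a a⁻¹
    rw [mul_inv_cancel, symb_one] at h
    rw [← sub_eq_zero, ← neg_eq_zero, h]
    abel

lemma eta_mul_mul_mem_K1 (a b : Fˣ) : eta F * symb a * symb b ∈ K1 F :=
  AddSubgroup.subset_closure
    ⟨[Gen.eta, Gen.symb a, Gen.symb b], by simp [Gen.deg], by simp [symb, eta, mul_assoc]⟩

variable (F) in
/-- The component of the truncation which restricts to `proj` on `K^MW_1(F)`. -/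
def projTotal : KMW F →+ Additive Fˣ where
  toFun x := (truncation F x (0, 1)).1
  map_zero' := by simp
  map_add' x y := by simp

lemma proj_eq (x : K1 F) : proj x = projTotal F x := rfl

@[simp] lemma projTotal_symb (a : Fˣ) : projTotal F (symb a) = Additive.ofMul a :=
  proj_symb a

@[simp] lemma projTotal_eta_mul (x : KMW F) : projTotal F (eta F * x) = 0 := by
  simp [projTotal, truncation]

lemma projTotal_of_mem_etaK2 {x : KMW F} (hx : x ∈ etaK2 F) : projTotal F x = 0 := by
  induction hx using AddSubgroup.closure_induction with
  | mem x hx => obtain ⟨a, b, rfl⟩ := hx; rw [mul_assoc, projTotal_eta_mul]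
  | zero => exact map_zero _
  | add x y _ _ hx hy => rw [map_add, hx, hy, add_zero]
  | neg x _ hx => rw [map_neg, hx, neg_zero]

/-- The kernel of `p : K^MW_1(F) → Fˣ` is `η K^MW_2(F)`. -/
lemma proj_eq_zero_iff (x : K1 F) : proj x = 0 ↔ (x : KMW F) ∈ etaK2 F := by
  refine ⟨fun h => ?_, fun h => projTotal_of_mem_etaK2 h⟩
  obtain ⟨a, n, hn, hx⟩ := exists_eq_symb_add x.2
  rw [proj_eq, hx, map_add, projTotal_symb, projTotal_of_mem_etaK2 hn, add_zero] at h
  have ha : a = 1 := h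
  rw [hx, ha, symb_one, zero_add]
  exact hn

end Kernel

/-! ### Symbols of squares -/

section Squares

variable {F : Type u} [Field F]

lemma symb_sq (c : Fˣ) : symb (c ^ 2) = hyp F * symb c := by
  rw [pow_two, symb_mul', angle_mul_symb, hyp_eq, add_mul, one_mul]

lemma eta_symb_sq (c : Fˣ) : eta F * symb (c ^ 2) = 0 := by
  rw [symb_sq, ← mul_assoc, eta_mul_hyp, zero_mul]

lemma symb_mul_sq (a c : Fˣ) : symb (a * c ^ 2) = symb a + symb (c ^ 2) := by
  rw [symb_mul, eta_comm, mul_assoc, eta_symb_sq, mul_zero, add_zero]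

variable (F) in
/-- The subgroup of the symbols `[c²] = h[c]`. -/
def squareSymbols : AddSubgroup (KMW F) where
  carrier := {x | ∃ c : Fˣ, x = symb (c ^ 2)}
  zero_mem' := ⟨1, by rw [one_pow, symb_one]⟩
  add_mem' := by
    rintro _ _ ⟨a, rfl⟩ ⟨b, rfl⟩
    exact ⟨a * b, by rw [mul_pow, symb_mul_sq]⟩
  neg_mem' := by
    rintro _ ⟨a, rfl⟩
    refine ⟨a⁻¹, ?_⟩
    rw [neg_eq_iff_add_eq_zero, ← symb_mul_sq, ← mul_pow, mul_inv_cancel, one_pow, symb_one]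

variable (F) in
/-- The symbol as a map to `K^MW_*(F)` modulo the symbols of squares, extended by zero. -/
def symbMod (a : F) : KMW F ⧸ squareSymbols F := by
  classical exact if h : a = 0 then 0 else (symb (Units.mk0 a h) : KMW F ⧸ squareSymbols F)

lemma symbMod_coe (a : Fˣ) : symbMod F a = (symb a : KMW F ⧸ squareSymbols F) := by
  rw [symbMod, dif_neg a.ne_zero, Units.mk0_val]

lemma mk_symb_mul_sq (a c : Fˣ) :
    (symb (a * c ^ 2) : KMW F ⧸ squareSymbols F) = symb a := by
  rw [symb_mul_sq]
  exact QuotientAddGroup.mk_add_of_mem _ (show symb (c ^ 2) ∈ squareSymbols F from ⟨c, rfl⟩)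

/-- The Steinberg relation for `a/(a + b)` and `b/(a + b)`. -/
lemma mk_symb_add_mk_symb (a b c : Fˣ) (h : (a : F) + b = c) :
    (symb a : KMW F ⧸ squareSymbols F) + symb b = symb c + symb (a * b * c) := by
  obtain ⟨t, rfl⟩ : ∃ t, a = c * t := ⟨c⁻¹ * a, by simp⟩
  obtain ⟨s, rfl⟩ : ∃ s, b = c * s := ⟨c⁻¹ * b, by simp⟩
  have hts : (t : F) + s = 1 := by
    have hc : (c : F) ≠ 0 := c.ne_zero
    apply mul_left_cancel₀ hc
    simpa [mul_add] using h
  have h0 := symb_mul_symb t s hts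
  have e1 : symb (t * s) = symb t + symb s := by
    rw [symb_mul, mul_assoc, h0, mul_zero, add_zero]
  rw [show c * t * (c * s) * c = c * (t * s) * c ^ 2 by
    rw [pow_two]; simp only [mul_comm, mul_left_comm], mk_symb_mul_sq,
    ← QuotientAddGroup.mk_add, ← QuotientAddGroup.mk_add]
  congr 1
  rw [symb_mul c t, symb_mul c s, symb_mul c (t * s), e1, mul_add]
  abel

/-- The symbol is an invariant of binary forms; so is its composite with a scaling by `c`, which
accounts for the multiples of isometry relations in the group ring. -/
lemma isBinaryInvariant_symbMod (c : Fˣ) : IsBinaryInvariant fun a => symbMod F (c * a) where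
  mul_sq a d ha hd := by
    have := mk_symb_mul_sq (c * Units.mk0 a ha) (Units.mk0 d hd)
    rw [← symbMod_coe, ← symbMod_coe] at this
    simpa [mul_assoc] using this
  binary a b ha hb hab := by
    have := mk_symb_add_mk_symb (c * Units.mk0 a ha) (c * Units.mk0 b hb)
      (c * Units.mk0 (a + b) hab) (by simp [mul_add])
    rw [show c * Units.mk0 a ha * (c * Units.mk0 b hb) * (c * Units.mk0 (a + b) hab)
      = c * (Units.mk0 a ha * Units.mk0 b hb * Units.mk0 (a + b) hab) * c ^ 2 by
        rw [pow_two]; simp only [mul_assoc, mul_comm, mul_left_comm], mk_symb_mul_sq] at this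
    simp only [← symbMod_coe] at this
    simpa using this

end Squares

/-! ### Relations in the Witt ring -/

section Relations

variable {F : Type u} [Field F]

variable (F) in
/-- The additive extension of `⟨a⟩ ↦ [a]` to the group ring of `Fˣ`. -/
def symbSum : MonoidAlgebra ℤ Fˣ →+ KMW F :=
  (Finsupp.liftAddHom fun a : Fˣ => (zmultiplesHom (KMW F)) (symb a)).comp
    MonoidAlgebra.coeffAddEquiv.toAddMonoidHom

@[simp] lemma symbSum_of (a : Fˣ) : symbSum F (MonoidAlgebra.of ℤ Fˣ a) = symb a := by
  simp [symbSum]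

variable (F) in
/-- The dimension of a virtual diagonal form. -/
def dimSum : MonoidAlgebra ℤ Fˣ →+* ℤ := (MonoidAlgebra.lift ℤ ℤ Fˣ 1).toRingHom

@[simp] lemma dimSum_of (a : Fˣ) : dimSum F (MonoidAlgebra.of ℤ Fˣ a) = 1 := by
  simp [dimSum]

/-- The sums of symbols along the relations of the Witt ring: modulo the symbols of squares, a
relation of dimension `2m` yields `m[-1]`. The extra factor `c` makes the statement stable under
multiplication by arbitrary elements of the group ring. -/
lemma symbSum_of_mem_span (h2 : (2 : F) ≠ 0) {X : MonoidAlgebra ℤ Fˣ}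
    (hX : X ∈ Ideal.span (wittRelations F)) (c : Fˣ) :
    ∃ m : ℤ, dimSum F X = 2 * m ∧
      (symbSum F (MonoidAlgebra.of ℤ Fˣ c * X) : KMW F ⧸ squareSymbols F)
        = m • ((symb (-1) : KMW F) : KMW F ⧸ squareSymbols F) := by
  induction hX using Submodule.span_induction generalizing c with
  | mem X hX =>
    rcases hX with ⟨n, a, b, hab, rfl⟩ | rfl
    · refine ⟨0, by simp only [map_sub, map_sum, dimSum_of]; simp, ?_⟩
      have h := sum_eq_of_equivalent h2 (isBinaryInvariant_symbMod c) hab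
      simp only [← Units.val_mul, symbMod_coe] at h
      have e : ∀ d : Fin n → Fˣ,
          (symbSum F (MonoidAlgebra.of ℤ Fˣ c * ∑ i, MonoidAlgebra.of ℤ Fˣ (d i)) :
            KMW F ⧸ squareSymbols F) = ∑ i, (symb (c * d i) : KMW F ⧸ squareSymbols F) :=
        fun d => by
          rw [Finset.mul_sum, map_sum, ← QuotientAddGroup.mk'_apply, map_sum]
          refine Finset.sum_congr rfl fun i _ => ?_
          rw [← map_mul, symbSum_of]
          rfl
      rw [zero_zsmul, mul_sub, map_sub, QuotientAddGroup.mk_sub, e, e, h, sub_self]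
    · refine ⟨1, by rw [map_add, dimSum_of, dimSum_of]; rfl, ?_⟩
      have h : symb (c * 1) + symb (c * -1) = symb (-1 * c ^ 2) := by
        rw [mul_one, mul_neg_one, show -1 * c ^ 2 = c * -c by rw [mul_neg, pow_two, neg_one_mul],
          symb_mul, mul_assoc, symb_mul_neg, mul_zero, add_zero]
      rw [mul_add, ← map_mul, ← map_mul, map_add, symbSum_of, symbSum_of, h, mk_symb_mul_sq,
        one_smul]
  | zero => exact ⟨0, by simp, by simp⟩
  | add X Y _ _ hX hY =>
    obtain ⟨m, hm, hX⟩ := hX c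
    obtain ⟨n, hn, hY⟩ := hY c
    refine ⟨m + n, by rw [map_add, hm, hn]; ring, ?_⟩
    rw [mul_add, map_add, QuotientAddGroup.mk_add, hX, hY, add_zsmul]
  | smul r X _ hX =>
    rw [smul_eq_mul]
    induction r using MonoidAlgebra.induction_on generalizing c with
    | of d =>
      obtain ⟨m, hm, hX⟩ := hX (c * d)
      exact ⟨m, by rw [map_mul, dimSum_of, one_mul, hm], by rw [← mul_assoc, ← map_mul, hX]⟩
    | add r s hr hs =>
      obtain ⟨m, hm, hr⟩ := hr c
      obtain ⟨n, hn, hs⟩ := hs c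
      refine ⟨m + n, by rw [add_mul, map_add, hm, hn]; ring, ?_⟩
      rw [add_mul, mul_add, map_add, QuotientAddGroup.mk_add, hr, hs, add_zsmul]
    | smul k r hr =>
      obtain ⟨m, hm, hr⟩ := hr c
      refine ⟨k * m, by rw [smul_mul_assoc, map_zsmul, hm, smul_eq_mul]; ring, ?_⟩
      rw [smul_mul_assoc, mul_smul_comm, map_zsmul, QuotientAddGroup.mk_zsmul, hr, mul_smul]

/-- A relation of dimension zero yields the symbol of a square. -/
lemma symbSum_mem_squareSymbols (h2 : (2 : F) ≠ 0) {X : MonoidAlgebra ℤ Fˣ}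
    (hX : X ∈ Ideal.span (wittRelations F)) (hd : dimSum F X = 0) :
    symbSum F X ∈ squareSymbols F := by
  obtain ⟨m, hm, h⟩ := symbSum_of_mem_span h2 hX 1
  have hm0 : m = 0 := by omega
  rw [map_one, one_mul, hm0, zero_zsmul] at h
  exact (QuotientAddGroup.eq_zero_iff _).1 h

variable (F) in
/-- The class in the Witt ring of a virtual diagonal form. -/
def wittMk : MonoidAlgebra ℤ Fˣ →+* WittRing F := Ideal.Quotient.mk (Ideal.span (wittRelations F))

lemma wittMk_of (a : Fˣ) : wittMk F (MonoidAlgebra.of ℤ Fˣ a) = oneDim a := rfl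

lemma wittMk_eq_zero_iff (X : MonoidAlgebra ℤ Fˣ) :
    wittMk F X = 0 ↔ X ∈ Ideal.span (wittRelations F) := Ideal.Quotient.eq_zero_iff_mem

lemma oneDim_mul (a b : Fˣ) : oneDim (a * b) = oneDim a * oneDim b := by
  rw [← wittMk_of, map_mul, map_mul, wittMk_of, wittMk_of]

lemma oneDim_one : oneDim (1 : Fˣ) = 1 := by rw [← wittMk_of, map_one, map_one]

lemma oneDim_neg_one : oneDim (-1 : Fˣ) = -1 := by
  have h : wittMk F (MonoidAlgebra.of ℤ Fˣ 1 + MonoidAlgebra.of ℤ Fˣ (-1)) = 0 :=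
    (wittMk_eq_zero_iff _).2 (Ideal.subset_span (Or.inr rfl))
  rw [map_add, wittMk_of, wittMk_of, oneDim_one] at h
  exact (neg_eq_of_add_eq_zero_right h).symm

lemma pfister_eq (a : Fˣ) : pfister a = 1 - oneDim a := by rw [pfister, oneDim_one]

/-- The isometry `⟨a, b⟩ ≅ ⟨1, ab⟩` for `a + b = 1`. -/
lemma equivalent_of_add_eq_one (a b : Fˣ) (h : (a : F) + b = 1) :
    (QuadraticMap.weightedSumSquares F ![a, b]).Equivalent
      (QuadraticMap.weightedSumSquares F ![1, a * b]) := by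
  let φ : (Fin 2 → F) ≃ₗ[F] (Fin 2 → F) :=
    { toFun := fun x => ![a * x 0 + b * x 1, x 0 - x 1]
      invFun := fun y => ![y 0 + b * y 1, y 0 - a * y 1]
      map_add' := fun x y => by
        ext i; fin_cases i <;> simp <;> ring
      map_smul' := fun c x => by
        ext i; fin_cases i <;> simp <;> ring
      left_inv := fun x => by
        ext i
        fin_cases i
        · simp; linear_combination x 0 * h
        · simp; linear_combination x 1 * h
      right_inv := fun y => by
        ext i
        fin_cases i
        · simp; linear_combination y 0 * h
        · simp; linear_combination y 1 * h }
  refine ⟨⟨φ, fun x => ?_⟩⟩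
  simp only [QuadraticMap.weightedSumSquares_apply, Fin.sum_univ_two, Units.smul_def, smul_eq_mul]
  simp [φ]
  linear_combination (a * x 0 ^ 2 + b * x 1 ^ 2) * h

lemma pfister_mul_pfister (a b : Fˣ) (h : (a : F) + b = 1) : pfister a * pfister b = 0 := by
  have h1 : wittMk F (∑ i, MonoidAlgebra.of ℤ Fˣ (![a, b] i)
      - ∑ i, MonoidAlgebra.of ℤ Fˣ (![1, a * b] i)) = 0 :=
    (wittMk_eq_zero_iff _).2
      (Ideal.subset_span (Or.inl ⟨2, _, _, equivalent_of_add_eq_one a b h, rfl⟩))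
  simp only [Fin.sum_univ_two, Matrix.cons_val_zero, Matrix.cons_val_one] at h1
  rw [map_sub, map_add, map_add] at h1
  simp only [wittMk_of, oneDim_one, oneDim_mul] at h1
  rw [pfister_eq, pfister_eq]
  linear_combination -h1

variable (F) in
/-- The ring homomorphism from Milnor–Witt K-theory to the Witt ring, with `[a] ↦ ⟨⟨a⟩⟩` and
`η ↦ -1`. -/
def toWitt : KMW F →+* WittRing F :=
  lift pfister (-1) pfister_mul_pfister
    (fun a b => by rw [pfister_eq, pfister_eq, pfister_eq, oneDim_mul]; ring)
    (fun a => by ring)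
    (by rw [pfister_eq, oneDim_neg_one]; ring)

@[simp] lemma toWitt_symb (a : Fˣ) : toWitt F (symb a) = pfister a := lift_symb _ _ _ _ _ _ a

@[simp] lemma toWitt_eta : toWitt F (eta F) = -1 := lift_eta _ _ _ _ _ _

lemma toWitt_eta_symb_symb (a b : Fˣ) :
    toWitt F (eta F * symb a * symb b) = -(pfister a * pfister b) := by
  rw [map_mul, map_mul, toWitt_eta, toWitt_symb, toWitt_symb]; ring

/-- Every element of `η K^MW_2(F)` comes from the square of the augmentation ideal of the group
ring, via `(1 - a)(1 - b) ↦ η[a][b]`. -/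
lemma exists_symbSum_eq {x : KMW F} (hx : x ∈ etaK2 F) :
    ∃ X : MonoidAlgebra ℤ Fˣ, symbSum F X = x ∧ dimSum F X = 0 ∧ wittMk F X = -toWitt F x := by
  induction hx using AddSubgroup.closure_induction with
  | mem x hx =>
    obtain ⟨a, b, rfl⟩ := hx
    refine ⟨MonoidAlgebra.of ℤ Fˣ 1 - MonoidAlgebra.of ℤ Fˣ a - MonoidAlgebra.of ℤ Fˣ b
      + MonoidAlgebra.of ℤ Fˣ (a * b), ?_, ?_, ?_⟩
    · rw [map_add, map_sub, map_sub, symbSum_of, symbSum_of, symbSum_of, symbSum_of, symb_one,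
        symb_mul]
      abel
    · rw [map_add, map_sub, map_sub, dimSum_of, dimSum_of, dimSum_of, dimSum_of]
      norm_num
    · rw [toWitt_eta_symb_symb, map_add, map_sub, map_sub, wittMk_of, wittMk_of, wittMk_of,
        wittMk_of, oneDim_mul, oneDim_one, pfister_eq, pfister_eq]
      ring
  | zero => exact ⟨0, by simp⟩
  | add x y _ _ hx hy =>
    obtain ⟨X, h1, h2, h3⟩ := hx
    obtain ⟨Y, h4, h5, h6⟩ := hy
    exact ⟨X + Y, by rw [map_add, h1, h4], by rw [map_add, h2, h5, add_zero],
      by rw [map_add, map_add, h3, h6, neg_add]⟩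
  | neg x _ hx =>
    obtain ⟨X, h1, h2, h3⟩ := hx
    exact ⟨-X, by rw [map_neg, h1], by rw [map_neg, h2, neg_zero], by rw [map_neg, map_neg, h3]⟩

/-- The map to the Witt ring is injective on `η K^MW_2(F)`: an element of the kernel is `[c²]` for
some `c`, and `p` maps it to `c² = 1`. -/
theorem eq_zero_of_toWitt_eq_zero (h2 : (2 : F) ≠ 0) {x : KMW F} (hx : x ∈ etaK2 F)
    (h : toWitt F x = 0) : x = 0 := by
  obtain ⟨X, rfl, hd, hw⟩ := exists_symbSum_eq hx
  rw [h, neg_zero, wittMk_eq_zero_iff] at hw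
  obtain ⟨c, hc⟩ := symbSum_mem_squareSymbols h2 hw hd
  have hp := projTotal_of_mem_etaK2 hx
  rw [hc, projTotal_symb] at hp
  have hc1 : c ^ 2 = 1 := hp
  rw [hc, hc1, symb_one]

/-- A one-dimensional form with trivial Pfister form is a square. -/
theorem isSquare_of_pfister_eq_zero (h2 : (2 : F) ≠ 0) {a : Fˣ} (h : pfister a = 0) :
    ∃ c : Fˣ, a = c ^ 2 := by
  have hw : wittMk F (MonoidAlgebra.of ℤ Fˣ a - MonoidAlgebra.of ℤ Fˣ 1) = 0 := by
    rw [map_sub, wittMk_of, wittMk_of, oneDim_one, ← neg_eq_zero, ← h, pfister_eq]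
    ring
  obtain ⟨c, hc⟩ := symbSum_mem_squareSymbols h2 ((wittMk_eq_zero_iff _).1 hw)
    (by rw [map_sub, dimSum_of, dimSum_of, sub_self])
  refine ⟨c, ?_⟩
  have := congrArg (projTotal F) hc
  rw [map_sub, symbSum_of, symbSum_of, symb_one, sub_zero, projTotal_symb, projTotal_symb] at this
  exact this

end Relations

/-! ### The embedding of the square of the fundamental ideal -/

section Embedding

variable {F : Type u} [Field F]

variable (F) in
/-- The additive group spanned by the one-fold Pfister forms. -/
def pfisterSpan : AddSubgroup (WittRing F) := AddSubgroup.closure (Set.range (pfister (F := F)))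

lemma exists_sub_mem_pfisterSpan (X : MonoidAlgebra ℤ Fˣ) :
    wittMk F X - (dimSum F X : WittRing F) ∈ pfisterSpan F := by
  induction X using MonoidAlgebra.induction_on with
  | of a =>
    rw [wittMk_of, dimSum_of, Int.cast_one, ← neg_sub, ← pfister_eq]
    exact neg_mem (AddSubgroup.subset_closure ⟨a, rfl⟩)
  | add X Y hX hY =>
    rw [map_add, map_add, Int.cast_add, add_sub_add_comm]
    exact add_mem hX hY
  | smul k X hX =>
    rw [map_zsmul, map_zsmul, smul_eq_mul, Int.cast_mul, ← zsmul_eq_mul, ← smul_sub]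
    exact zsmul_mem hX k

/-- The fundamental ideal is additively generated by the Pfister forms `⟨⟨a⟩⟩`; twice the unit is
`⟨⟨-1⟩⟩`. -/
lemma mem_pfisterSpan {y : WittRing F} (hy : y ∈ fundamentalIdeal F) : y ∈ pfisterSpan F := by
  obtain ⟨X, hX⟩ : ∃ X, wittMk F X = y := Ideal.Quotient.mk_surjective y
  subst hX
  have hd : ∀ Y : MonoidAlgebra ℤ Fˣ, dimMod2 F (wittMk F Y) = (dimSum F Y : ZMod 2) := fun Y => by
    induction Y using MonoidAlgebra.induction_on with
    | of a =>
      rw [dimSum_of, Int.cast_one]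
      exact (Ideal.Quotient.lift_mk _ _ _).trans (by simp)
    | add X Y hX hY => rw [map_add, map_add, hX, hY, map_add, Int.cast_add]
    | smul k X hX => rw [map_zsmul, map_zsmul, hX, map_zsmul, smul_eq_mul, Int.cast_mul,
        zsmul_eq_mul]
  rw [fundamentalIdeal, RingHom.mem_ker, hd] at hy
  obtain ⟨m, hm⟩ := (ZMod.intCast_zmod_eq_zero_iff_dvd _ 2).1 hy
  have h := exists_sub_mem_pfisterSpan X
  have h' : (dimSum F X : WittRing F) ∈ pfisterSpan F := by
    have e : (dimSum F X : WittRing F) = m • pfister (-1) := by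
      rw [hm, pfister_eq, oneDim_neg_one, zsmul_eq_mul]
      push_cast
      ring
    rw [e]
    exact zsmul_mem (AddSubgroup.subset_closure (Set.mem_range_self (-1 : Fˣ))) m
  simpa using add_mem h h'

lemma iSq_induction {P : WittRing F → Prop} (hp : ∀ a b, P (pfister a * pfister b)) (h0 : P 0)
    (hadd : ∀ x y, P x → P y → P (x + y)) (hneg : ∀ x, P x → P (-x)) (y : WittRing F)
    (hy : y ∈ ISq F) : P y := by
  rw [ISq, pow_two] at hy
  induction hy using Submodule.mul_induction_on' with
  | mem_mul_mem x hx y hy =>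
    replace hx := mem_pfisterSpan hx
    replace hy := mem_pfisterSpan hy
    induction hx, hy using AddSubgroup.closure_induction₂ with
    | mem x y hx hy =>
      obtain ⟨a, rfl⟩ := hx
      obtain ⟨b, rfl⟩ := hy
      exact hp a b
    | zero_left x hx => rw [zero_mul]; exact h0
    | zero_right x hx => rw [mul_zero]; exact h0
    | add_left x y z _ _ _ h h' => rw [add_mul]; exact hadd _ _ h h'
    | add_right x y z _ _ _ h h' => rw [mul_add]; exact hadd _ _ h h'
    | neg_left x y _ _ h => rw [neg_mul]; exact hneg _ h
    | neg_right x y _ _ h => rw [mul_neg]; exact hneg _ h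
  | add x _ y _ hx hy => exact hadd x y hx hy

variable (F) in
/-- The map `-toWitt` on the kernel of `p`, with values in `I²(F)`. -/
def kerToISq : (proj (F := F)).ker →+ ISq F where
  toFun x := ⟨-toWitt F x, by
    have hx : ((x : K1 F) : KMW F) ∈ etaK2 F := (proj_eq_zero_iff _).1 x.2
    generalize ((x : K1 F) : KMW F) = y at hx
    induction hx using AddSubgroup.closure_induction with
    | mem y hy =>
      obtain ⟨a, b, rfl⟩ := hy
      rw [toWitt_eta_symb_symb, neg_neg]
      exact (pfister₂ a b).2
    | zero => simp
    | add y z _ _ hy hz => rw [map_add, neg_add]; exact add_mem hy hz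
    | neg y _ hy => rw [map_neg]; exact neg_mem hy⟩
  map_zero' := by ext; simp
  map_add' x y := by ext; simp; ring

lemma kerToISq_injective (h2 : (2 : F) ≠ 0) : Function.Injective (kerToISq F) := by
  rw [injective_iff_map_eq_zero]
  intro x hx
  have h : -toWitt F ((x : K1 F) : KMW F) = 0 := congrArg Subtype.val hx
  exact Subtype.ext (Subtype.ext (eq_zero_of_toWitt_eq_zero h2 ((proj_eq_zero_iff _).1 x.2)
    (neg_eq_zero.1 h)))

variable (F) in
/-- The element `η[a][b]` of the kernel of `p`. -/
def etaSymbSymb (a b : Fˣ) : (proj (F := F)).ker :=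
  ⟨⟨eta F * symb a * symb b, eta_mul_mul_mem_K1 a b⟩,
    (proj_eq_zero_iff _).2 (eta_symb_symb_mem a b)⟩

lemma kerToISq_etaSymbSymb (a b : Fˣ) : kerToISq F (etaSymbSymb F a b) = pfister₂ a b :=
  Subtype.ext ((congrArg Neg.neg (toWitt_eta_symb_symb a b)).trans (neg_neg _))

lemma kerToISq_surjective : Function.Surjective (kerToISq F) := by
  rintro ⟨y, hy⟩
  suffices h : ∃ x, (kerToISq F x : WittRing F) = y from h.imp fun x hx => Subtype.ext hx
  refine iSq_induction (P := fun y => ∃ x, (kerToISq F x : WittRing F) = y)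
    (fun a b => ⟨etaSymbSymb F a b, congrArg Subtype.val (kerToISq_etaSymbSymb a b)⟩)
    ⟨0, by rw [map_zero]; rfl⟩ ?_ ?_ y hy
  · rintro _ _ ⟨x, rfl⟩ ⟨y, rfl⟩
    exact ⟨x + y, by rw [map_add]; rfl⟩
  · rintro _ ⟨x, rfl⟩
    exact ⟨-x, by rw [map_neg]; rfl⟩

/-- In characteristic different from `2`, the isomorphism of `I²(F)` with the kernel of `p`. -/
def iSqEquivKer (h2 : (2 : F) ≠ 0) : ISq F ≃+ (proj (F := F)).ker :=
  (AddEquiv.ofBijective (kerToISq F) ⟨kerToISq_injective h2, kerToISq_surjective⟩).symm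

/-- In characteristic different from `2`, the homomorphism `I²(F) → K^MW_1(F)` with
`⟨⟨a, b⟩⟩ ↦ η[a][b]`. -/
def iSqToK1 (h2 : (2 : F) ≠ 0) : ISq F →+ K1 F :=
  (proj (F := F)).ker.subtype.comp (iSqEquivKer h2).toAddMonoidHom

lemma iSqToK1_pfister₂ (h2 : (2 : F) ≠ 0) (a b : Fˣ) :
    (iSqToK1 h2 (pfister₂ a b) : KMW F) = eta F * symb a * symb b := by
  have h : iSqEquivKer h2 (pfister₂ a b) = etaSymbSymb F a b := by
    rw [← kerToISq_etaSymbSymb]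
    exact AddEquiv.symm_apply_apply _ _
  exact congrArg (fun x : (proj (F := F)).ker => ((x : K1 F) : KMW F)) h

lemma iSqToK1_injective (h2 : (2 : F) ≠ 0) : Function.Injective (iSqToK1 h2) :=
  Subtype.val_injective.comp (iSqEquivKer h2).injective

lemma proj_iSqToK1 (h2 : (2 : F) ≠ 0) (y : ISq F) : proj (iSqToK1 h2 y) = 0 :=
  (iSqEquivKer h2 y).2

lemma exists_iSqToK1_eq (h2 : (2 : F) ≠ 0) {x : K1 F} (hx : proj x = 0) :
    ∃ y, iSqToK1 h2 y = x := by
  obtain ⟨y, hy⟩ := (iSqEquivKer h2).surjective ⟨x, hx⟩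
  exact ⟨y, congrArg Subtype.val hy⟩

end Embedding

/-! ### Discretely valued fields with finite residue field of odd characteristic -/

section Local

lemma pfister_mul_sq {F : Type u} [Field F] (a c : Fˣ) : pfister (a * c ^ 2) = pfister a := by
  have h : toWitt F (symb (c ^ 2)) = 0 := by
    rw [symb_sq, map_mul, hyp, map_add, map_mul, toWitt_eta, toWitt_symb, pfister_eq (-1 : Fˣ),
      oneDim_neg_one, map_ofNat]
    ring
  rw [← toWitt_symb, symb_mul_sq, map_add, h, add_zero, toWitt_symb]

lemma oneDim_mul_self {F : Type u} [Field F] (a : Fˣ) : oneDim a * oneDim a = 1 := by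
  have h := pfister_mul_sq 1 a
  rw [one_mul, pfister_eq, pfister_eq, oneDim_one, sub_self, pow_two, oneDim_mul] at h
  exact (sub_eq_zero.1 h).symm

/-- If `⟨a, b⟩` represents `1`, then `⟨⟨a, b⟩⟩ = 0`. -/
lemma pfister_mul_pfister_of_represents {F : Type u} [Field F] (a b : Fˣ) (x y : F)
    (h : a * x ^ 2 + b * y ^ 2 = 1) : pfister a * pfister b = 0 := by
  have aux : ∀ (c : Fˣ) (z : F), (c : F) * z ^ 2 = 1 → pfister c = 0 := fun c z hz => by
    have hz0 : z ≠ 0 := by rintro rfl; simp at hz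
    rw [← pfister_mul_sq c (Units.mk0 z hz0),
      show c * Units.mk0 z hz0 ^ 2 = 1 from Units.ext (by simpa using hz), pfister_eq, oneDim_one,
      sub_self]
  by_cases hx : x = 0
  · rw [aux b y (by simpa [hx] using h), mul_zero]
  by_cases hy : y = 0
  · rw [aux a x (by simpa [hy] using h), zero_mul]
  rw [← pfister_mul_sq a (Units.mk0 x hx), ← pfister_mul_sq b (Units.mk0 y hy)]
  exact pfister_mul_pfister _ _ (by simpa using h)

/-- Over a finite field of odd characteristic, every nondegenerate binary form represents `1`. -/
lemma exists_represents_one {k : Type*} [Field k] [Finite k] (h2 : (2 : k) ≠ 0) (a b : k)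
    (ha : a ≠ 0) (hb : b ≠ 0) : ∃ x y : k, a * x ^ 2 + b * y ^ 2 = 1 := by
  have := Fintype.ofFinite k
  have hodd : Fintype.card k % 2 = 1 := FiniteField.odd_card_of_char_ne_two fun h => h2 (by
    have := CharP.cast_eq_zero k (ringChar k)
    rw [h] at this
    exact_mod_cast this)
  obtain ⟨x, y, h⟩ := FiniteField.exists_root_sum_quadratic
    (f := Polynomial.C a * Polynomial.X ^ 2)
    (g := Polynomial.C b * Polynomial.X ^ 2 + Polynomial.C 0 * Polynomial.X + Polynomial.C (-1))
    (Polynomial.degree_C_mul_X_pow 2 ha) (Polynomial.degree_quadratic hb) hodd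
  refine ⟨x, y, ?_⟩
  simp at h
  linear_combination h

variable {K : Type u} [Field K] {w : Valuation K (WithZero (Multiplicative ℤ))} {π : Kˣ}

/-- The properties of the valuation of a local field of odd residue characteristic that matter for
the symbols of units. Of completeness, only the consequence is kept that principal units are
squares; discreteness enters through the choice of a uniformizer. -/
structure IsOddLocal (w : Valuation K (WithZero (Multiplicative ℤ))) : Prop where
  finite : Finite (IsLocalRing.ResidueField w.valuationSubring)
  val_two : w 2 = 1
  isSquare : ∀ u : K, w (u - 1) < 1 → ∃ z, u = z ^ 2

lemma val_sub_lt_one {x y : w.valuationSubring}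
    (h : IsLocalRing.residue w.valuationSubring x = IsLocalRing.residue w.valuationSubring y) :
    w (x - y : K) < 1 := by
  rw [← sub_eq_zero, ← map_sub, IsLocalRing.residue_eq_zero_iff, Valuation.mem_maximalIdeal_iff] at h
  exact h

lemma residue_ne_zero {x : w.valuationSubring} (h : w (x : K) = 1) :
    IsLocalRing.residue w.valuationSubring x ≠ 0 := by
  intro h0
  have := val_sub_lt_one (x := x) (y := 0) (by rw [h0, map_zero])
  simp [h] at this

lemma IsOddLocal.two_ne_zero (hw : IsOddLocal w) : (2 : K) ≠ 0 := by
  intro h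
  have := hw.val_two
  rw [h, map_zero] at this
  exact zero_ne_one this

lemma IsOddLocal.residue_two_ne_zero (hw : IsOddLocal w) :
    (2 : IsLocalRing.ResidueField w.valuationSubring) ≠ 0 := by
  have := residue_ne_zero (w := w) (x := 2) hw.val_two
  rwa [map_ofNat] at this

/-- A unit which is a square in the residue field is a square. -/
lemma IsOddLocal.isSquare_of_residue (hw : IsOddLocal w) (x : w.valuationSubring)
    (hx : w (x : K) = 1) (c : IsLocalRing.ResidueField w.valuationSubring)
    (hc : IsLocalRing.residue w.valuationSubring x = c ^ 2) :
    ∃ z : K, (x : K) = z ^ 2 := by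
  obtain ⟨y, rfl⟩ := IsLocalRing.residue_surjective c
  have h1 : w ((x : K) - (y : K) ^ 2) < 1 := by
    have := val_sub_lt_one (x := x) (y := y ^ 2) (by rw [hc, map_pow])
    simpa using this
  have hy : w ((y : K) ^ 2) = 1 := by
    rw [← hx]
    exact Valuation.map_eq_of_sub_lt w (by rwa [Valuation.map_sub_swap, hx])
  have hy0 : (y : K) ≠ 0 := by
    intro h
    simp [h] at hy
  obtain ⟨z, hz⟩ := hw.isSquare ((x : K) / (y : K) ^ 2) (by
    rwa [div_sub_one (pow_ne_zero 2 hy0), map_div₀, hy, div_one])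
  refine ⟨z * y, ?_⟩
  rw [mul_pow, ← hz, div_mul_cancel₀ _ (pow_ne_zero 2 hy0)]

/-- The form `⟨⟨a, b⟩⟩` vanishes for units `a` and `b`, since `⟨a, b⟩` represents `1` over the
residue field. -/
lemma IsOddLocal.pfister_mul_pfister (hw : IsOddLocal w) (a b : Kˣ) (ha : w a = 1)
    (hb : w b = 1) : pfister a * pfister b = 0 := by
  have := hw.finite
  let a' : w.valuationSubring := ⟨a, ha.le⟩
  let b' : w.valuationSubring := ⟨b, hb.le⟩
  obtain ⟨x, y, h⟩ := exists_represents_one hw.residue_two_ne_zero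
    (IsLocalRing.residue _ a') (IsLocalRing.residue _ b') (residue_ne_zero ha) (residue_ne_zero hb)
  obtain ⟨x, rfl⟩ := IsLocalRing.residue_surjective x
  obtain ⟨y, rfl⟩ := IsLocalRing.residue_surjective y
  simp only [← map_pow, ← map_mul, ← map_add] at h
  rw [← map_one (IsLocalRing.residue w.valuationSubring)] at h
  have h1 : w ((a * x ^ 2 + b * y ^ 2 : K) - 1) < 1 := val_sub_lt_one h
  obtain ⟨z, hz⟩ := hw.isSquare _ h1
  have hz0 : z ≠ 0 := by
    rintro rfl
    rw [hz] at h1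
    simp at h1
  refine pfister_mul_pfister_of_represents a b (x / z) (y / z) ?_
  field_simp
  exact hz

/-- The Pfister form `⟨⟨a⟩⟩` depends only on the unit part of `a` and on the parity of its order. -/
lemma exists_unit_part (hπ : IsUniformizer w π) (a : Kˣ) : ∃ b : Kˣ, w b = 1 ∧
    (pfister a = pfister b ∨ pfister a = pfister (π * b)) := by
  refine ⟨a * π ^ (-ord w a), unitPart_val hπ a, ?_⟩
  rcases Int.even_or_odd' (ord w a) with ⟨m, hm | hm⟩
  · left
    rw [← pfister_mul_sq a (π ^ (-m)), hm, ← zpow_natCast, ← zpow_mul]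
    congr 3
    push_cast
    ring
  · right
    rw [← pfister_mul_sq a (π ^ (-m)), hm, mul_left_comm, ← zpow_natCast, ← zpow_mul,
      ← zpow_one_add]
    congr 3
    push_cast
    ring

/-- Over a local field of odd residue characteristic, every element of `I²` is of the form
`⟨⟨π, b⟩⟩` for a unit `b`. -/
lemma IsOddLocal.exists_eq_pfister (hw : IsOddLocal w) (hπ : IsUniformizer w π) (y : WittRing K)
    (hy : y ∈ ISq K) : ∃ b : Kˣ, w b = 1 ∧ y = pfister π * pfister b := by
  refine iSq_induction (P := fun y => ∃ b : Kˣ, w b = 1 ∧ y = pfister π * pfister b)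
    (fun a b => ?_) ⟨1, by simp, by rw [pfister_eq (1 : Kˣ), oneDim_one, sub_self, mul_zero]⟩
    ?_ ?_ y hy
  · obtain ⟨a, ha, h1⟩ := exists_unit_part hπ a
    obtain ⟨b, hb, h2⟩ := exists_unit_part hπ b
    have hab := hw.pfister_mul_pfister a b ha hb
    have hpp := oneDim_mul_self π
    have hun : w ((-(a * b) : Kˣ) : K) = 1 := by
      rw [Units.val_neg, Valuation.map_neg, Units.val_mul, map_mul, ha, hb, one_mul]
    have hneg : (oneDim (-(a * b)) : WittRing K) = -(oneDim a * oneDim b) := by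
      rw [← neg_one_mul, oneDim_mul, oneDim_neg_one, oneDim_mul, neg_one_mul]
    rcases h1 with h1 | h1 <;> rcases h2 with h2 | h2 <;> rw [h1, h2]
    · exact ⟨1, by simp, by rw [hab, pfister_eq (1 : Kˣ), oneDim_one, sub_self, mul_zero]⟩
    · refine ⟨a, ha, ?_⟩
      simp only [pfister_eq, oneDim_mul] at hab ⊢
      linear_combination oneDim π * hab
    · refine ⟨b, hb, ?_⟩
      simp only [pfister_eq, oneDim_mul] at hab ⊢
      linear_combination oneDim π * hab
    · refine ⟨-(a * b), hun, ?_⟩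
      simp only [pfister_eq, oneDim_mul, hneg] at hab ⊢
      linear_combination oneDim π * hab + oneDim a * oneDim b * hpp
  · rintro _ _ ⟨a, ha, rfl⟩ ⟨b, hb, rfl⟩
    have hab := hw.pfister_mul_pfister a b ha hb
    refine ⟨a * b, by rw [Units.val_mul, map_mul, ha, hb, one_mul], ?_⟩
    simp only [pfister_eq, oneDim_mul] at hab ⊢
    linear_combination (1 - oneDim π) * hab
  · rintro _ ⟨b, hb, rfl⟩
    have hbb := hw.pfister_mul_pfister b b hb hb
    have hb1 := oneDim_mul_self b
    refine ⟨b, hb, ?_⟩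
    simp only [pfister_eq] at hbb ⊢
    linear_combination (oneDim π - 1) * (hbb - hb1)

/-- Over a local field of odd residue characteristic, the residue map is injective on the kernel
of the projection to Milnor K-theory. -/
theorem IsOddLocal.eq_zero_of_residueMap (hw : IsOddLocal w) (hπ : IsUniformizer w π) {x : K1 K}
    (hx : proj x = 0) (hr : residueMap hπ x = 0) : x = 0 := by
  have hx' : (x : KMW K) ∈ etaK2 K := (proj_eq_zero_iff x).1 hx
  obtain ⟨b, hb, h⟩ := hw.exists_eq_pfister hπ _ (kerToISq K ⟨x, hx⟩).2
  have h' : toWitt K (x : KMW K) = -(pfister π * pfister b) := neg_eq_iff_eq_neg.1 h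
  have e : (x : KMW K) = eta K * symb π * symb b := by
    rw [← sub_eq_zero]
    refine eq_zero_of_toWitt_eq_zero hw.two_ne_zero (sub_mem hx' (eta_symb_symb_mem π b)) ?_
    rw [map_sub, toWitt_eta_symb_symb, h', sub_self]
  have hord : ord w b = 0 := ord_eq w (by rw [hb, neg_zero, WithZero.exp_zero])
  have hres := residueMap_uniformizer_mul_units hπ [b] (by simpa using hord)
  simp only [List.map_cons, List.map_nil, List.prod_cons, List.prod_nil, mul_one] at hres
  rw [e, mul_assoc, residueMap_eta_mul, hres] at hr
  have hp := congrArg (toWitt _) hr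
  rw [map_mul, toWitt_eta, toWitt_symb, map_zero, neg_one_mul, neg_eq_zero] at hp
  obtain ⟨c, hc⟩ := isSquare_of_pfister_eq_zero hw.residue_two_ne_zero hp
  have hc' := congrArg Units.val hc
  rw [angular_val, Units.val_pow_eq_pow_val] at hc'
  obtain ⟨z, hz⟩ := hw.isSquare_of_residue _ (unitPart_val hπ b) _ hc'
  simp only [hord, neg_zero, zpow_zero, mul_one] at hz
  have hz0 : z ≠ 0 := by rintro rfl; simp at hz
  have hb2 : b = Units.mk0 z hz0 ^ 2 := Units.ext (by simpa using hz)
  apply Subtype.ext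
  rw [e, mul_assoc, hb2, ← one_mul (_ ^ 2), symb_mul_sq, symb_one, zero_add, ← mul_assoc, eta_comm,
    mul_assoc, eta_symb_sq, mul_zero]
  rfl

end Local

/-! ### Completions of a number field -/

section Completions

/-- Hensel's lemma for square roots: in a complete ultrametric field of odd residue characteristic,
principal units are squares, by Newton's iteration `z ↦ (z + u/z)/2`. -/
lemma exists_eq_sq_of_norm_sub_one_lt {K : Type*} [NormedField K] [CompleteSpace K]
    (hna : ∀ x y : K, ‖x + y‖ ≤ max ‖x‖ ‖y‖) (h2 : ‖(2 : K)‖ = 1) (t : K) (ht : ‖t - 1‖ < 1) :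
    ∃ z, t = z ^ 2 := by
  have h20 : (2 : K) ≠ 0 := by
    intro h
    rw [h, norm_zero] at h2
    exact zero_ne_one h2
  have hunit : ∀ s : K, ‖s - 1‖ < 1 → ‖s‖ = 1 := fun s hs => by
    apply le_antisymm
    · have := hna (s - 1) 1
      rw [sub_add_cancel, norm_one] at this
      exact this.trans (max_le hs.le le_rfl)
    · by_contra! hlt
      have := hna (-(s - 1)) s
      rw [neg_sub, sub_add_cancel, norm_one, norm_sub_rev] at this
      exact absurd (max_lt hs hlt) (not_lt.2 this)
  let z : ℕ → K := fun n => Nat.rec 1 (fun _ x => (x + t / x) / 2) n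
  have hz : ∀ n, z (n + 1) = (z n + t / z n) / 2 := fun n => rfl
  have key : ∀ n, ‖z n - 1‖ < 1 ∧ ‖t - z n ^ 2‖ ≤ ‖t - 1‖ ^ (n + 1) := by
    intro n
    induction n with
    | zero => simp [z]
    | succ n ih =>
      obtain ⟨h1, h3⟩ := ih
      have hn := hunit _ h1
      have hn0 : z n ≠ 0 := by intro h; rw [h, norm_zero] at hn; exact zero_ne_one hn
      have hlt : ‖t - z n ^ 2‖ < 1 := h3.trans_lt (pow_lt_one₀ (norm_nonneg _) ht (by simp))
      have e1 : z (n + 1) - 1 = (z n - 1) + (t - z n ^ 2) / (2 * z n) := by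
        rw [hz]; field_simp; ring
      have e2 : t - z (n + 1) ^ 2 = -((t - z n ^ 2) / (2 * z n)) ^ 2 := by
        rw [hz]; field_simp; ring
      have e3 : ‖(t - z n ^ 2) / (2 * z n)‖ = ‖t - z n ^ 2‖ := by
        rw [norm_div, norm_mul, h2, hn, one_mul, div_one]
      refine ⟨?_, ?_⟩
      · rw [e1]
        refine (hna _ _).trans_lt (max_lt h1 ?_)
        rwa [e3]
      · rw [e2, norm_neg, norm_pow, e3, pow_two ‖t - z n ^ 2‖, pow_succ ‖t - 1‖]
        refine mul_le_mul h3 ?_ (norm_nonneg _) (pow_nonneg (norm_nonneg _) _)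
        exact h3.trans (pow_le_of_le_one (norm_nonneg _) ht.le (by simp))
  have hcauchy : CauchySeq z := by
    refine cauchySeq_of_le_geometric ‖t - 1‖ 1 ht fun n => ?_
    obtain ⟨h1, h3⟩ := key n
    have hn := hunit _ h1
    have hn0 : z n ≠ 0 := by intro h; rw [h, norm_zero] at hn; exact zero_ne_one hn
    have e : z (n + 1) - z n = (t - z n ^ 2) / (2 * z n) := by
      rw [hz]; field_simp; ring
    rw [dist_comm, dist_eq_norm, e, norm_div, norm_mul, h2, hn, one_mul, div_one, one_mul]
    exact h3.trans (pow_le_pow_of_le_one (norm_nonneg _) ht.le (Nat.le_succ n))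
  obtain ⟨l, hl⟩ := cauchySeq_tendsto_of_complete hcauchy
  refine ⟨l, ?_⟩
  have h1 : Tendsto (fun n => t - z n ^ 2) atTop (nhds (t - l ^ 2)) :=
    tendsto_const_nhds.sub (hl.pow 2)
  have h3 : Tendsto (fun n => t - z n ^ 2) atTop (nhds 0) := by
    refine squeeze_zero_norm (fun n => (key n).2) ?_
    exact (tendsto_pow_atTop_nhds_zero_of_lt_one (norm_nonneg _) ht).comp (tendsto_add_atTop_nat 1)
  exact sub_eq_zero.1 (tendsto_nhds_unique h1 h3)

variable {F : Type u} [Field F] [NumberField F]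

lemma norm_lt_one_iff_val_lt_one (v : HeightOneSpectrum (𝓞 F)) (x : v.adicCompletion F) :
    ‖x‖ < 1 ↔ Valued.v x < 1 := by
  rw [FinitePlace.norm_def, ← NNReal.coe_one, NNReal.coe_lt_coe,
    WithZeroMulInt.toNNReal_lt_one_iff (NumberField.HeightOneSpectrum.one_lt_absNorm_nnreal v)]

/-- The ring of integers of the number field is dense modulo the maximal ideal of the completion, so
that the residue field of the completion is a quotient of `𝓞 F`. -/
lemma exists_integer_sub_lt_one (v : HeightOneSpectrum (𝓞 F)) (x : v.adicCompletion F)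
    (hx : Valued.v x ≤ 1) :
    ∃ r : 𝓞 F, Valued.v (x - algebraMap F (v.adicCompletion F) r) < 1 := by
  obtain ⟨y, hy⟩ := (HeightOneSpectrum.denseRange_algebraMap F v).exists_dist_lt x one_pos
  rw [dist_eq_norm, norm_lt_one_iff_val_lt_one] at hy
  have hval : ∀ z : F, Valued.v (algebraMap F (v.adicCompletion F) z) = v.valuation F z :=
    fun z => v.valuedAdicCompletion_eq_valuation' z
  have hy1 : v.valuation F y ≤ 1 := by
    rw [← hval, ← sub_sub_cancel x (algebraMap F (v.adicCompletion F) y)]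
    exact (Valuation.map_sub _ _ _).trans (max_le hx hy.le)
  obtain ⟨r, hr⟩ := v.exists_valuation_sub_lt_of_integer hy1 1
  refine ⟨r, ?_⟩
  rw [← sub_add_sub_cancel x (algebraMap F (v.adicCompletion F) y)]
  refine (Valuation.map_add _ _ _).trans_lt (max_lt hy ?_)
  rw [Valuation.map_sub_swap, ← map_sub, hval]
  exact hr

lemma finite_residueField (v : HeightOneSpectrum (𝓞 F)) :
    Finite (IsLocalRing.ResidueField (v.adicCompletionIntegers F)) := by
  let f : 𝓞 F →+* IsLocalRing.ResidueField (v.adicCompletionIntegers F) :=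
    (IsLocalRing.residue _).comp (algebraMap (𝓞 F) (v.adicCompletionIntegers F))
  have hf : Function.Surjective f := by
    intro c
    obtain ⟨x, rfl⟩ := IsLocalRing.residue_surjective c
    obtain ⟨r, hr⟩ := exists_integer_sub_lt_one v x x.2
    exact ⟨r, (residue_eq_of_val_sub hr).symm⟩
  have hker : ∀ r ∈ v.asIdeal, f r = 0 := fun r hr => by
    have h : Valued.v ((algebraMap (𝓞 F) (v.adicCompletionIntegers F) r : v.adicCompletion F))
        < 1 := by
      refine (v.valuedAdicCompletion_eq_valuation r).trans_lt ?_
      exact (v.valuation_lt_one_iff_mem r).2 hr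
    refine (residue_eq_of_val_sub (y := 0) ?_).trans (map_zero _)
    simpa using h
  exact Finite.of_surjective (Ideal.Quotient.lift v.asIdeal f hker)
    (Ideal.Quotient.lift_surjective_of_surjective _ hker hf)

lemma isOddLocal (v : HeightOneSpectrum (𝓞 F)) (hv : (2 : 𝓞 F) ∉ v.asIdeal) :
    IsOddLocal (Valued.v : Valuation (v.adicCompletion F) (WithZero (Multiplicative ℤ))) := by
  have h2 : Valued.v (2 : v.adicCompletion F) = 1 := by
    have h := v.valuedAdicCompletion_eq_valuation' (2 : F)
    have e : algebraMap F (v.adicCompletion F) 2 = 2 := map_ofNat _ 2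
    rw [← e]
    refine h.trans (le_antisymm ?_ ?_)
    · exact_mod_cast v.valuation_le_one (K := F) 2
    · by_contra! hlt
      exact hv ((v.valuation_lt_one_iff_mem (K := F) 2).1 
        ((congrArg (v.valuation F) (map_ofNat (algebraMap (𝓞 F) F) 2)).trans_lt hlt))
  refine ⟨finite_residueField v, h2, fun t ht => ?_⟩
  refine exists_eq_sq_of_norm_sub_one_lt (fun x y => ?_) ?_ t
    ((norm_lt_one_iff_val_lt_one v _).2 ht)
  · simp only [FinitePlace.norm_def]
    rw [← NNReal.coe_max, NNReal.coe_le_coe, ← (WithZeroMulInt.toNNReal_strictMono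
      (NumberField.HeightOneSpectrum.one_lt_absNorm_nnreal v)).monotone.map_max]
    exact (WithZeroMulInt.toNNReal_strictMono
      (NumberField.HeightOneSpectrum.one_lt_absNorm_nnreal v)).monotone (Valuation.map_add _ _ _)
  · rw [FinitePlace.norm_def, h2, map_one, NNReal.coe_one]

variable (F) in
lemma finite_setOf_two_mem : {v : HeightOneSpectrum (𝓞 F) | (2 : 𝓞 F) ∈ v.asIdeal}.Finite := by
  have h : Ideal.span {(2 : 𝓞 F)} ≠ 0 := by
    rw [Ideal.zero_eq_bot, Ne, Ideal.span_singleton_eq_bot]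
    exact two_ne_zero
  refine (Ideal.finite_factors h).subset fun v hv => ?_
  exact Ideal.dvd_span_singleton.2 hv

lemma exists_isUniformizer (v : HeightOneSpectrum (𝓞 F)) : ∃ π : (v.adicCompletion F)ˣ,
    IsUniformizer (Valued.v : Valuation (v.adicCompletion F) (WithZero (Multiplicative ℤ))) π := by
  obtain ⟨π₀, hπ₀⟩ := v.valuation_exists_uniformizer F
  have hv : (Valued.v (π₀ : v.adicCompletion F)) = WithZero.exp (-1 : ℤ) := by
    rw [HeightOneSpectrum.valuedAdicCompletion_eq_valuation', hπ₀]
  refine ⟨Units.mk0 (π₀ : v.adicCompletion F) fun h => ?_, ord_eq _ hv⟩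
  rw [h, map_zero] at hv
  exact WithZero.exp_ne_zero hv.symm

lemma completion_two_ne_zero (v : Place F) : (2 : v.Completion) ≠ 0 := by
  have key : ∀ {L : Type u} [Field L] (_ : F →+* L), (2 : L) ≠ 0 := fun {L} _ f h => by
    rw [← map_ofNat f 2, map_eq_zero] at h
    exact two_ne_zero h
  match v with
  | .inl v => exact key (L := v.Completion) (algebraMap F v.Completion)
  | .inr v => exact key (L := v.adicCompletion F) (algebraMap F (v.adicCompletion F))

/-- At a place not above `2`, no nonzero element of the kernel of `p` is integral. -/
lemma eq_zero_of_mem_integralK1 (v : HeightOneSpectrum (𝓞 F)) (hv : (2 : 𝓞 F) ∉ v.asIdeal)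
    {x : K1 (v.adicCompletion F)} (hx : proj x = 0)
    (hi : x ∈ integralK1 (.inr v : Place F)) : x = 0 := by
  obtain ⟨π, hπ⟩ := exists_isUniformizer v
  have h : residueMap hπ (x : KMW (v.adicCompletion F)) = 0 :=
    (AddSubgroup.mem_iInf.1 ((AddSubgroup.mem_iInf.1 hi) π)) hπ
  exact (isOddLocal v hv).eq_zero_of_residueMap hπ hx h

/-- The symbol of a unit is integral. -/
lemma symb_mem_integralK1 (v : HeightOneSpectrum (𝓞 F))
    (a : (v.adicCompletion F)ˣ) (ha : a ∈ integralUnits (.inr v : Place F)) :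
    (⟨symb a, symb_mem a⟩ : K1 (v.adicCompletion F)) ∈ integralK1 (.inr v : Place F) := by
  have ha' : Valued.v (a : v.adicCompletion F) = 1 :=
    (Valuation.mem_unitGroup_iff (v.adicCompletion F) Valued.v _).1 ha
  refine AddSubgroup.mem_iInf.2 fun π => AddSubgroup.mem_iInf.2 fun hπ => ?_
  have h0 : ord Valued.v a = 0 := ord_eq _ (by rw [ha', neg_zero, WithZero.exp_zero])
  have h := residueMap_units hπ [a] (by simpa using h0)
  rw [List.map_singleton, List.prod_singleton] at h
  exact h

lemma eventually_finite_odd : ∀ᶠ v : Place F in cofinite,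
    ∃ w : HeightOneSpectrum (𝓞 F), v = Sum.inr w ∧ (2 : 𝓞 F) ∉ w.asIdeal := by
  refine ((Set.finite_range (Sum.inl : InfinitePlace F → Place F)).union
    ((finite_setOf_two_mem F).image Sum.inr)).subset ?_
  rintro (v | v) hv
  · exact Or.inl ⟨v, rfl⟩
  · right
    refine ⟨v, ?_, rfl⟩
    by_contra h
    exact hv ⟨v, rfl, h⟩

variable (F) in
/-- The homomorphism from the direct sum of the groups `I²(F_v)` to the Milnor–Witt idèles. -/
def iSqToIdele : (DirectSum (Place F) fun v => ISq v.Completion) →+ MWIdele F where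
  toFun y := ⟨fun v => iSqToK1 (completion_two_ne_zero v) (y v), by
    classical
    filter_upwards [(DFinsupp.finite_support y).compl_mem_cofinite] with v hv
    have h0 : y v = 0 := by simpa using hv
    rw [h0, map_zero]
    exact zero_mem _⟩
  map_zero' := by ext v; simp
  map_add' y z := by ext v; exact congrArg Subtype.val (map_add (iSqToK1 _) (y v) (z v))

end Completions

end MilnorWitt
end

theorem proposition4p2 (F : Type*) [Field F] [NumberField F] :
    ∃ (j : ∀ v : MilnorWitt.Place F,
          MilnorWitt.ISq v.Completion →+ MilnorWitt.K1 v.Completion)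
      (ι : (DirectSum (MilnorWitt.Place F) fun v => MilnorWitt.ISq v.Completion) →+
          MilnorWitt.MWIdele F),
      (∀ (v : MilnorWitt.Place F) (a b : (v.Completion)ˣ),
        (j v (MilnorWitt.pfister₂ a b) : MilnorWitt.KMW v.Completion) =
          MilnorWitt.eta v.Completion * MilnorWitt.symb a * MilnorWitt.symb b) ∧
      (∀ x v, ι x v = j v (x v)) ∧
      Function.Injective ι ∧
      Function.Exact ι (MilnorWitt.ideleProj F) ∧
      Function.Surjective (MilnorWitt.ideleProj F) := by
  classical
  refine ⟨fun v => MilnorWitt.iSqToK1 (MilnorWitt.completion_two_ne_zero v),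
    MilnorWitt.iSqToIdele F, fun v a b => MilnorWitt.iSqToK1_pfister₂ _ a b, fun _ _ => rfl,
    fun x y h => ?_, fun x => ⟨fun h => ?_, ?_⟩, fun a => ?_⟩
  · refine DFinsupp.ext fun v => ?_
    exact MilnorWitt.iSqToK1_injective (MilnorWitt.completion_two_ne_zero v)
      (congrArg (fun z : MilnorWitt.MWIdele F => z v) h)
  · have hv : ∀ v, MilnorWitt.proj (x v) = 0 := fun v =>
      congrArg (fun z : Additive (MilnorWitt.Idele F) => Additive.ofMul (z.toMul v)) h
    choose y hy using fun v => MilnorWitt.exists_iSqToK1_eq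
      (MilnorWitt.completion_two_ne_zero v) (hv v)
    -- An integral element of the kernel vanishes at almost all places.
    have hfin : {v | y v ≠ 0}.Finite := by
      have h0 : ∀ᶠ v in cofinite, y v = 0 := by
        filter_upwards [x.2, MilnorWitt.eventually_finite_odd] with v hx ⟨w, hw, h2⟩
        apply MilnorWitt.iSqToK1_injective (MilnorWitt.completion_two_ne_zero v)
        rw [hy, map_zero]
        subst hw
        exact MilnorWitt.eq_zero_of_mem_integralK1 w h2 (hv (.inr w)) hx
      exact h0
    refine ⟨DirectSum.mk _ hfin.toFinset fun v => y v, ?_⟩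
    ext v
    apply congrArg Subtype.val
    refine Eq.trans ?_ (hy v)
    apply congrArg (MilnorWitt.iSqToK1 _)
    by_cases h0 : y v = 0
    · rw [h0]
      exact DirectSum.mk_apply_of_notMem (by simpa using h0)
    · exact DirectSum.mk_apply_of_mem (hfin.mem_toFinset.2 h0)
  · rintro ⟨y, rfl⟩
    apply congrArg Additive.ofMul
    ext v
    exact congrArg _ (MilnorWitt.proj_iSqToK1 (MilnorWitt.completion_two_ne_zero v) (y v))
  · refine ⟨⟨fun v => ⟨MilnorWitt.symb (a.toMul v), MilnorWitt.symb_mem _⟩, ?_⟩, ?_⟩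
    · filter_upwards [a.toMul.2, MilnorWitt.eventually_finite_odd] with v ha ⟨w, hw, _⟩
      subst hw
      exact MilnorWitt.symb_mem_integralK1 w _ ha
    · refine congrArg Additive.ofMul (RestrictedProduct.ext _ _ fun v => ?_ : _ = a.toMul)
      exact congrArg Additive.toMul (MilnorWitt.proj_symb (a.toMul v))
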